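/- For a real matrix $X\in\mathbb R^{m\times n}$ and a set $\mathcal S\subseteq\{1,\dots,n\}$ let $X_{\mathcal S}$ be the submatrix formed by the columns of $X$ with index in $\mathcal S$, and let $\mathrm{Vol}(X_{\mathcal S})=\sqrt{\det(X_{\mathcal S}X_{\mathcal S}^T)}$. There are an algorithm and an absolute constant $C>0$ with the following property. Let $1\le m\le n$, let $X\in\mathbb R^{m\times n}$ have rank $m$, let $k$ be an integer with $m\le k\le \min(2m-1,n)$, and let $c>1$ be real. On input $(m,n,k,c,X)$ the algorithm halts after at most $$C\left(nm^2\max\{1,\log\log m\}+\frac{nm^2}{\log c}\right)$$ operations (for $m=1$ the maximum is read as $1$) and outputs a set $\mathcal S\subseteq\{1,\dots,n\}$ with $|\mathcal S|=k$ such that $$\mathrm{Vol}(X_{\mathcal S})\ \ge\ \frac{c^{-m}}{\sqrt{\binom{2m-1}{m}}}\ \max_{\mathcal T\subseteq\{1,\dots,n\},\ |\mathcal T|=k}\mathrm{Vol}(X_{\mathcal T}).$$ The algorithm is one fixed program, the same for all inputs, of a real random access machine: it works with exact real numbers ($+,-,\times,/$ and comparisons) and with natural numbers used as indices and counters, and every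 arithmetic operation, comparison, index operation, memory access and assignment counts as one operation. -/

import Mathlib

/-- The volume of the submatrix `X_S` formed by the columns of `X` with index in `S`:
`Vol (X_S) = √ det (X_S X_Sᵀ)`. -/
noncomputable def colVolume {m n : ℕ} (X : Matrix (Fin m) (Fin n) ℝ) (S : Finset (Fin n)) : ℝ :=
  Real.sqrt ((X.submatrix id ((↑) : S → Fin n)) *
    (X.submatrix id ((↑) : S → Fin n)).transpose).det

/-! A real random access machine, programmed in a small imperative language.  It has natural number
variables and arrays (for indices and counters) and real variables and two-dimensional arrays.
Real data can influence natural numbers and control flow only through comparisons.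
Every operation, evaluation of a constant, variable access, array access, test and assignment costs one step. -/

namespace RealRAM

/-- The memory.  Variables and arrays are named by natural numbers. -/
structure Store where
  /-- natural number variables -/
  natVar : ℕ → ℕ
  /-- natural number arrays: name, position -/
  natArr : ℕ → ℕ → ℕ
  /-- real variables -/
  realVar : ℕ → ℝ
  /-- real arrays: name, row, column -/
  realArr : ℕ → ℕ → ℕ → ℝ

/-- Index expressions. -/
inductive NExp where
  | const (a : ℕ)
  | var (x : ℕ)
  | arr (a : ℕ) (i : NExp)
  | add (e f : NExp)
  | sub (e f : NExp)

/-- Value of an index expression (subtraction is truncated at `0`). -/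
def NExp.eval (σ : Store) : NExp → ℕ
  | .const a => a
  | .var x => σ.natVar x
  | .arr a i => σ.natArr a (i.eval σ)
  | .add e f => e.eval σ + f.eval σ
  | .sub e f => e.eval σ - f.eval σ

/-- Number of steps needed to evaluate an index expression. -/
def NExp.cost : NExp → ℕ
  | .const _ => 1
  | .var _ => 1
  | .arr _ i => i.cost + 1
  | .add e f => e.cost + f.cost + 1
  | .sub e f => e.cost + f.cost + 1

/-- Real expressions: the four arithmetic operations, memory access and conversion of an index
to a real number. -/
inductive RExp where
  | ofNat (e : NExp)
  | var (x : ℕ)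
  | arr (a : ℕ) (i j : NExp)
  | add (e f : RExp)
  | sub (e f : RExp)
  | mul (e f : RExp)
  | div (e f : RExp)

/-- Value of a real expression (a division by zero returns `0`). -/
noncomputable def RExp.eval (σ : Store) : RExp → ℝ
  | .ofNat e => (e.eval σ : ℝ)
  | .var x => σ.realVar x
  | .arr a i j => σ.realArr a (i.eval σ) (j.eval σ)
  | .add e f => e.eval σ + f.eval σ
  | .sub e f => e.eval σ - f.eval σ
  | .mul e f => e.eval σ * f.eval σ
  | .div e f => e.eval σ / f.eval σ

/-- Number of steps needed to evaluate a real expression. -/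
def RExp.cost : RExp → ℕ
  | .ofNat e => e.cost + 1
  | .var _ => 1
  | .arr _ i j => i.cost + j.cost + 1
  | .add e f => e.cost + f.cost + 1
  | .sub e f => e.cost + f.cost + 1
  | .mul e f => e.cost + f.cost + 1
  | .div e f => e.cost + f.cost + 1

/-- Tests. -/
inductive BExp where
  | natLt (e f : NExp)
  | realLt (e f : RExp)
  | not (b : BExp)
  | and (b d : BExp)

/-- Truth of a test. -/
def BExp.eval (σ : Store) : BExp → Prop
  | .natLt e f => e.eval σ < f.eval σ
  | .realLt e f => e.eval σ < f.eval σ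
  | .not b => ¬ b.eval σ
  | .and b d => b.eval σ ∧ d.eval σ

/-- Number of steps needed to evaluate a test. -/
def BExp.cost : BExp → ℕ
  | .natLt e f => e.cost + f.cost + 1
  | .realLt e f => e.cost + f.cost + 1
  | .not b => b.cost + 1
  | .and b d => b.cost + d.cost + 1

/-- Programs. -/
inductive Program where
  | skip
  | setNat (x : ℕ) (e : NExp)
  | setNatArr (a : ℕ) (i e : NExp)
  | setReal (x : ℕ) (e : RExp)
  | setRealArr (a : ℕ) (i j : NExp) (e : RExp)
  | seq (p q : Program)
  | ite (b : BExp) (p q : Program)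
  | while (b : BExp) (p : Program)

/-- Store the natural number `v` in the variable `x`. -/
def Store.setNat (σ : Store) (x v : ℕ) : Store :=
  { σ with natVar := fun x' => if x' = x then v else σ.natVar x' }

/-- Store the natural number `v` at position `i` of the array `a`. -/
def Store.setNatArr (σ : Store) (a i v : ℕ) : Store :=
  { σ with natArr := fun a' i' => if a' = a ∧ i' = i then v else σ.natArr a' i' }

/-- Store the real number `v` in the variable `x`. -/
def Store.setReal (σ : Store) (x : ℕ) (v : ℝ) : Store :=
  { σ with realVar := fun x' => if x' = x then v else σ.realVar x' }

/-- Store the real number `v` at position `(i, j)` of the array `a`. -/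
def Store.setRealArr (σ : Store) (a i j : ℕ) (v : ℝ) : Store :=
  { σ with realArr := fun a' i' j' =>
      if a' = a ∧ i' = i ∧ j' = j then v else σ.realArr a' i' j' }

/-- `Exec p σ t τ`: started with memory `σ`, the program `p` halts after exactly `t` steps with
memory `τ`. -/
inductive Exec : Program → Store → ℕ → Store → Prop where
  | skip (σ : Store) : Exec .skip σ 1 σ
  | setNat (x : ℕ) (e : NExp) (σ : Store) :
      Exec (.setNat x e) σ (e.cost + 1) (σ.setNat x (e.eval σ))
  | setNatArr (a : ℕ) (i e : NExp) (σ : Store) :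
      Exec (.setNatArr a i e) σ (i.cost + e.cost + 1)
        (σ.setNatArr a (i.eval σ) (e.eval σ))
  | setReal (x : ℕ) (e : RExp) (σ : Store) :
      Exec (.setReal x e) σ (e.cost + 1) (σ.setReal x (e.eval σ))
  | setRealArr (a : ℕ) (i j : NExp) (e : RExp) (σ : Store) :
      Exec (.setRealArr a i j e) σ (i.cost + j.cost + e.cost + 1)
        (σ.setRealArr a (i.eval σ) (j.eval σ) (e.eval σ))
  | seq {p q : Program} {σ τ υ : Store} {t u : ℕ} :
      Exec p σ t τ → Exec q τ u υ → Exec (.seq p q) σ (t + u) υ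
  | iteTrue {b : BExp} {p q : Program} {σ τ : Store} {t : ℕ} :
      b.eval σ → Exec p σ t τ → Exec (.ite b p q) σ (b.cost + t + 1) τ
  | iteFalse {b : BExp} {p q : Program} {σ τ : Store} {t : ℕ} :
      ¬ b.eval σ → Exec q σ t τ → Exec (.ite b p q) σ (b.cost + t + 1) τ
  | whileFalse {b : BExp} {p : Program} {σ : Store} :
      ¬ b.eval σ → Exec (.while b p) σ (b.cost + 1) σ
  | whileTrue {b : BExp} {p : Program} {σ τ υ : Store} {t u : ℕ} :
      b.eval σ → Exec p σ t τ → Exec (.while b p) τ u υ →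
        Exec (.while b p) σ (b.cost + t + u + 1) υ

/-- Initial memory: the natural variables `0, 1, 2` hold `m, n, k`, the real variable `0` holds `c`,
the real array `0` holds `X` (rows and columns counted from `0`), everything else is `0`. -/
def input {m n : ℕ} (X : Matrix (Fin m) (Fin n) ℝ) (k : ℕ) (c : ℝ) : Store where
  natVar x := if x = 0 then m else if x = 1 then n else if x = 2 then k else 0
  natArr _ _ := 0
  realVar x := if x = 0 then c else 0
  realArr a i j := if h : a = 0 ∧ i < m ∧ j < n then X ⟨i, h.2.1⟩ ⟨j, h.2.2⟩ else 0

/-- The memory `τ` outputs the column set `S` : the first `|S|` entries of the natural array `0`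
list the elements of `S`, each exactly once. -/
def Outputs {n : ℕ} (τ : Store) (S : Finset (Fin n)) : Prop :=
  ∃ s : Fin S.card → Fin n, Function.Injective s ∧ Finset.univ.image s = S ∧
    ∀ i : Fin S.card, τ.natArr 0 i = s i

end RealRAM

/-! The algorithm rounds an approximately D-optimal design. For a probability weight `p` on the
columns let `M = ∑ p i • x_i x_iᵀ`. If `x_iᵀ M⁻¹ x_i ≤ c² m` for all `i`, AM–GM for eigenvalues
gives `det (X_T X_Tᵀ) ≤ (k c²)^m det M` for every `T` of size `k` (`det_moment_indicatorWeight_le`).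

Conversely, Gram–Schmidt for the inner product `M⁻¹` with largest pivots picks `m` columns whose
squared determinant is at least `m! det M`: after `l` steps the `p`-average of the projected squared
lengths is `m - l`, so the largest is no smaller (`GramSchmidt.factorial_mul_det_le`). Each column
then added greedily at least doubles the determinant as long as it is below `m^m det M`
(`exists_one_lt_columnForm`). The `k` columns thus reach `min (m^m) (2^(k-m) m!) * det M`, and both
terms of the minimum are at least `k^m / binom(2m-1, m)` (`pow_le_choose_mul_pow`,
`pow_le_choose_mul_two_pow`). Square roots give the claim.

The weight comes from Frank–Wolfe steps, started at the uniform weight on `m` columns that a first,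
Euclidean Gram–Schmidt run selects. There the logarithmic gap `u` to the optimum, divided by `m`, is
at most `log m` (`uniformWeight_spec`). If `h` is the logarithm of the largest `x_iᵀ M⁻¹ x_i / m`,
then `u ≤ h`, and a step lowers `u` by at least `(h - 1 + exp (-h)) / m` (`gap_le_log`,
`gap_shiftWeight_le`). A potential function turns this into `O(m (max 1 (log log m) + 1 / log c))`
steps (`potential_step`, `potential_sub_le`).

A step costs `O(nm)`, because only `W` and `M⁻¹ W` are kept, under rank one updates; Gram–Schmidt
and the greedy extension take at most `m` rounds of that cost. Changing coordinates to `W = T X`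
multiplies all determinants by `det T ^ 2` and does not affect the comparison. -/

namespace RealRAM

/-! ### Reasoning about programs: frames, weakest preconditions with step counts, loops. -/

/-- Natural number variables assigned by a program. -/
def Program.natVars : Program → List ℕ
  | .setNat x _ => [x]
  | .seq p q => p.natVars ++ q.natVars
  | .ite _ p q => p.natVars ++ q.natVars
  | .while _ p => p.natVars
  | _ => []

/-- Natural number arrays written by a program. -/
def Program.natArrs : Program → List ℕ
  | .setNatArr a _ _ => [a]
  | .seq p q => p.natArrs ++ q.natArrs
  | .ite _ p q => p.natArrs ++ q.natArrs
  | .while _ p => p.natArrs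
  | _ => []

/-- Real variables assigned by a program. -/
def Program.realVars : Program → List ℕ
  | .setReal x _ => [x]
  | .seq p q => p.realVars ++ q.realVars
  | .ite _ p q => p.realVars ++ q.realVars
  | .while _ p => p.realVars
  | _ => []

/-- Real arrays written by a program. -/
def Program.realArrs : Program → List ℕ
  | .setRealArr a _ _ _ => [a]
  | .seq p q => p.realArrs ++ q.realArrs
  | .ite _ p q => p.realArrs ++ q.realArrs
  | .while _ p => p.realArrs
  | _ => []

/-- `τ` and `σ` agree on all variables and arrays that `p` does not write. -/
structure Frame (p : Program) (σ τ : Store) : Prop where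
  natVar : ∀ x, x ∉ p.natVars → τ.natVar x = σ.natVar x
  natArr : ∀ x, x ∉ p.natArrs → τ.natArr x = σ.natArr x
  realVar : ∀ x, x ∉ p.realVars → τ.realVar x = σ.realVar x
  realArr : ∀ x, x ∉ p.realArrs → τ.realArr x = σ.realArr x

theorem Frame.refl (p : Program) (σ : Store) : Frame p σ σ :=
  ⟨fun _ _ => rfl, fun _ _ => rfl, fun _ _ => rfl, fun _ _ => rfl⟩

theorem Frame.trans {p : Program} {σ τ υ : Store} (h : Frame p σ τ) (h' : Frame p τ υ) :
    Frame p σ υ :=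
  ⟨fun x hx => (h'.natVar x hx).trans (h.natVar x hx),
    fun x hx => (h'.natArr x hx).trans (h.natArr x hx),
    fun x hx => (h'.realVar x hx).trans (h.realVar x hx),
    fun x hx => (h'.realArr x hx).trans (h.realArr x hx)⟩

theorem Frame.mono {p q : Program} {σ τ : Store} (h : Frame p σ τ)
    (h1 : p.natVars ⊆ q.natVars) (h2 : p.natArrs ⊆ q.natArrs)
    (h3 : p.realVars ⊆ q.realVars) (h4 : p.realArrs ⊆ q.realArrs) : Frame q σ τ :=
  ⟨fun x hx => h.natVar x fun h => hx (h1 h), fun x hx => h.natArr x fun h => hx (h2 h),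
    fun x hx => h.realVar x fun h => hx (h3 h), fun x hx => h.realArr x fun h => hx (h4 h)⟩

theorem Frame.seqLeft {p q : Program} {σ τ : Store} (h : Frame p σ τ) : Frame (.seq p q) σ τ :=
  h.mono (by simp [Program.natVars]) (by simp [Program.natArrs]) (by simp [Program.realVars])
    (by simp [Program.realArrs])

theorem Frame.seqRight {p q : Program} {σ τ : Store} (h : Frame q σ τ) : Frame (.seq p q) σ τ :=
  h.mono (by simp [Program.natVars]) (by simp [Program.natArrs]) (by simp [Program.realVars])
    (by simp [Program.realArrs])

theorem Exec.frame {p : Program} {σ τ : Store} {t : ℕ} (h : Exec p σ t τ) : Frame p σ τ := by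
  induction h with
  | skip σ => exact Frame.refl _ _
  | setNat x e σ =>
    refine ⟨fun y hy => ?_, fun _ _ => rfl, fun _ _ => rfl, fun _ _ => rfl⟩
    have : y ≠ x := by simpa [Program.natVars] using hy
    simp [Store.setNat, this]
  | setNatArr a i e σ =>
    refine ⟨fun _ _ => rfl, fun y hy => ?_, fun _ _ => rfl, fun _ _ => rfl⟩
    have : y ≠ a := by simpa [Program.natArrs] using hy
    funext i; simp [Store.setNatArr, this]
  | setReal x e σ =>
    refine ⟨fun _ _ => rfl, fun _ _ => rfl, fun y hy => ?_, fun _ _ => rfl⟩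
    have : y ≠ x := by simpa [Program.realVars] using hy
    simp [Store.setReal, this]
  | setRealArr a i j e σ =>
    refine ⟨fun _ _ => rfl, fun _ _ => rfl, fun _ _ => rfl, fun y hy => ?_⟩
    have : y ≠ a := by simpa [Program.realArrs] using hy
    funext i; simp [Store.setRealArr, this]
  | seq _ _ h1 h2 => exact h1.seqLeft.trans h2.seqRight
  | iteTrue _ _ h =>
    exact h.mono (by simp [Program.natVars]) (by simp [Program.natArrs])
      (by simp [Program.realVars]) (by simp [Program.realArrs])
  | iteFalse _ _ h =>
    exact h.mono (by simp [Program.natVars]) (by simp [Program.natArrs])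
      (by simp [Program.realVars]) (by simp [Program.realArrs])
  | whileFalse _ => exact Frame.refl _ _
  | whileTrue _ _ _ h1 h2 =>
    exact Frame.trans (h1.mono (fun _ h => h) (fun _ h => h) (fun _ h => h) (fun _ h => h)) h2

/-- Started in `σ`, the program `p` halts with a step count and a memory that satisfy `Q`. -/
def wp (p : Program) (σ : Store) (Q : ℕ → Store → Prop) : Prop :=
  ∃ t τ, Exec p σ t τ ∧ Q t τ

theorem wp.mono {p : Program} {σ : Store} {Q Q' : ℕ → Store → Prop} (h : wp p σ Q)
    (h' : ∀ t τ, Frame p σ τ → Q t τ → Q' t τ) : wp p σ Q' := by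
  obtain ⟨t, τ, h1, h2⟩ := h
  exact ⟨t, τ, h1, h' t τ h1.frame h2⟩

theorem wp_skip {σ : Store} {Q : ℕ → Store → Prop} (h : Q 1 σ) : wp .skip σ Q :=
  ⟨_, _, .skip σ, h⟩

theorem wp_setNat {x : ℕ} {e : NExp} {σ : Store} {Q : ℕ → Store → Prop}
    (h : Q (e.cost + 1) (σ.setNat x (e.eval σ))) : wp (.setNat x e) σ Q :=
  ⟨_, _, .setNat x e σ, h⟩

theorem wp_setNatArr {a : ℕ} {i e : NExp} {σ : Store} {Q : ℕ → Store → Prop}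
    (h : Q (i.cost + e.cost + 1) (σ.setNatArr a (i.eval σ) (e.eval σ))) :
    wp (.setNatArr a i e) σ Q :=
  ⟨_, _, .setNatArr a i e σ, h⟩

theorem wp_setReal {x : ℕ} {e : RExp} {σ : Store} {Q : ℕ → Store → Prop}
    (h : Q (e.cost + 1) (σ.setReal x (e.eval σ))) : wp (.setReal x e) σ Q :=
  ⟨_, _, .setReal x e σ, h⟩

theorem wp_setRealArr {a : ℕ} {i j : NExp} {e : RExp} {σ : Store} {Q : ℕ → Store → Prop}
    (h : Q (i.cost + j.cost + e.cost + 1) (σ.setRealArr a (i.eval σ) (j.eval σ) (e.eval σ))) :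
    wp (.setRealArr a i j e) σ Q :=
  ⟨_, _, .setRealArr a i j e σ, h⟩

theorem wp_seq {p q : Program} {σ : Store} {Q : ℕ → Store → Prop}
    (h : wp p σ fun t τ => wp q τ fun u υ => Q (t + u) υ) : wp (.seq p q) σ Q := by
  obtain ⟨t, τ, h1, u, υ, h2, h3⟩ := h
  exact ⟨_, _, .seq h1 h2, h3⟩

theorem wp_ite {b : BExp} {p q : Program} {σ : Store} {Q : ℕ → Store → Prop}
    (ht : b.eval σ → wp p σ fun t τ => Q (b.cost + t + 1) τ)
    (hf : ¬ b.eval σ → wp q σ fun t τ => Q (b.cost + t + 1) τ) : wp (.ite b p q) σ Q := by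
  by_cases h : b.eval σ
  · obtain ⟨t, τ, h1, h2⟩ := ht h
    exact ⟨_, _, .iteTrue h h1, h2⟩
  · obtain ⟨t, τ, h1, h2⟩ := hf h
    exact ⟨_, _, .iteFalse h h1, h2⟩

/-- A loop whose body decreases a natural number that is an upper bound on the number of
iterations left. -/
theorem wp_while {b : BExp} {p : Program} {T : ℕ} (I : ℕ → Store → Prop)
    (step : ∀ v σ, I v σ → b.eval σ →
      wp p σ fun t τ => t ≤ T ∧ ∃ v', v' < v ∧ I v' τ) :
    ∀ (v : ℕ) (σ : Store), I v σ →
      wp (.while b p) σ fun t τ =>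
        t ≤ v * (T + b.cost + 1) + (b.cost + 1) ∧ (∃ v', I v' τ) ∧ ¬ b.eval τ := by
  intro v
  induction v using Nat.strong_induction_on with
  | _ v ih =>
    intro σ h
    by_cases hb : b.eval σ
    · obtain ⟨t, τ, h1, ht, v', hv, hI⟩ := step v σ h hb
      obtain ⟨u, υ, h2, hu, hQ⟩ := ih v' hv τ hI
      refine ⟨_, _, .whileTrue hb h1 h2, ?_, hQ⟩
      have : (v' + 1) * (T + b.cost + 1) ≤ v * (T + b.cost + 1) := Nat.mul_le_mul_right _ hv
      linarith [Nat.succ_mul v' (T + b.cost + 1)]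
    · exact ⟨_, _, .whileFalse hb, by omega, ⟨v, h⟩, hb⟩

/-- `loop x y p` executes `p` for all values of the variable `x` below the value of the variable
`y`. -/
def loop (x y : ℕ) (p : Program) : Program :=
  .seq (.setNat x (.const 0))
    (.while (.natLt (.var x) (.var y)) (.seq p (.setNat x (.add (.var x) (.const 1)))))

/-- The body receives the frame of the whole loop, so the invariant need not mention memory that the
loop never writes. The `8` is the cost of test and increment per round, the `6` that of
initialization and the last test. -/
theorem wp_loop {x y : ℕ} {p : Program} {σ : Store} {T : ℕ} (I : ℕ → Store → Prop)
    (hx : x ∉ p.natVars) (hy : y ∉ p.natVars) (hxy : y ≠ x)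
    (init : I 0 (σ.setNat x 0))
    (step : ∀ i < σ.natVar y, ∀ τ, Frame (loop x y p) σ τ → τ.natVar x = i → I i τ →
      wp p τ fun t υ => t ≤ T ∧ I (i + 1) (υ.setNat x (i + 1))) :
    wp (loop x y p) σ fun t τ => t ≤ σ.natVar y * (T + 8) + 6 ∧ I (σ.natVar y) τ := by
  have hyl : y ∉ (loop x y p).natVars := by simp [loop, Program.natVars, hxy, hy]
  apply wp_seq
  apply wp_setNat
  have key := wp_while (b := .natLt (.var x) (.var y))
    (p := .seq p (.setNat x (.add (.var x) (.const 1)))) (T := T + 4)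
    (fun v τ => Frame (loop x y p) σ τ ∧ τ.natVar x + v = σ.natVar y ∧ I (τ.natVar x) τ) ?_
    (σ.natVar y) (σ.setNat x 0) ?_
  · refine key.mono fun t τ _ ⟨ht, ⟨v, hF, hv, hI⟩, hb⟩ => ?_
    have hyτ := hF.natVar y hyl
    simp only [BExp.eval, NExp.eval, hyτ, not_lt] at hb
    have : τ.natVar x = σ.natVar y := by omega
    rw [this] at hI
    refine ⟨?_, hI⟩
    simp only [BExp.cost, NExp.cost] at ht ⊢
    calc _ ≤ 1 + 1 + (σ.natVar y * (T + 4 + (1 + 1 + 1) + 1) + (1 + 1 + 1 + 1)) := by omega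
      _ = _ := by ring
  · rintro v τ ⟨hF, hv, hI⟩ hb
    have hyτ := hF.natVar y hyl
    simp only [BExp.eval, NExp.eval, hyτ] at hb
    apply wp_seq
    refine (step _ hb τ hF rfl hI).mono fun t υ hFr ⟨ht, hI'⟩ => ?_
    have hυ := hFr.natVar x hx
    apply wp_setNat
    simp only [NExp.eval, NExp.cost, hυ]
    refine ⟨by omega, v - 1, by omega, hF.trans ?_, ?_, ?_⟩
    · have h1 : Frame (.setNat x (.add (.var x) (.const 1))) υ (υ.setNat x (τ.natVar x + 1)) := by
        have := (Exec.setNat x (.add (.var x) (.const 1)) υ).frame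
        simpa only [NExp.eval, hυ] using this
      have h2 : Frame (.seq p (.setNat x (.add (.var x) (.const 1)))) τ
        (υ.setNat x (τ.natVar x + 1)) := hFr.seqLeft.trans h1.seqRight
      exact Frame.seqRight (h2.mono (fun _ h => h) (fun _ h => h) (fun _ h => h) (fun _ h => h))
    · simp only [Store.setNat, if_pos]; omega
    · simpa only [Store.setNat, if_pos] using hI'
  · refine ⟨?_, by simp [Store.setNat], by simpa [Store.setNat] using init⟩
    exact Frame.seqLeft (Exec.setNat x (.const 0) σ).frame

@[simp] theorem setNat_natVar (σ : Store) (x v y : ℕ) :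
    (σ.setNat x v).natVar y = if y = x then v else σ.natVar y := rfl
@[simp] theorem setNat_natArr (σ : Store) (x v : ℕ) : (σ.setNat x v).natArr = σ.natArr := rfl
@[simp] theorem setNat_realVar (σ : Store) (x v : ℕ) : (σ.setNat x v).realVar = σ.realVar := rfl
@[simp] theorem setNat_realArr (σ : Store) (x v : ℕ) : (σ.setNat x v).realArr = σ.realArr := rfl
@[simp] theorem setNatArr_natVar (σ : Store) (a i v : ℕ) :
    (σ.setNatArr a i v).natVar = σ.natVar := rfl
@[simp] theorem setNatArr_natArr (σ : Store) (a i v a' i' : ℕ) :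
    (σ.setNatArr a i v).natArr a' i' = if a' = a ∧ i' = i then v else σ.natArr a' i' := rfl
@[simp] theorem setNatArr_realVar (σ : Store) (a i v : ℕ) :
    (σ.setNatArr a i v).realVar = σ.realVar := rfl
@[simp] theorem setNatArr_realArr (σ : Store) (a i v : ℕ) :
    (σ.setNatArr a i v).realArr = σ.realArr := rfl
@[simp] theorem setReal_natVar (σ : Store) (x : ℕ) (v : ℝ) :
    (σ.setReal x v).natVar = σ.natVar := rfl
@[simp] theorem setReal_natArr (σ : Store) (x : ℕ) (v : ℝ) :
    (σ.setReal x v).natArr = σ.natArr := rfl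
@[simp] theorem setReal_realVar (σ : Store) (x : ℕ) (v : ℝ) (y : ℕ) :
    (σ.setReal x v).realVar y = if y = x then v else σ.realVar y := rfl
@[simp] theorem setReal_realArr (σ : Store) (x : ℕ) (v : ℝ) :
    (σ.setReal x v).realArr = σ.realArr := rfl
@[simp] theorem setRealArr_realArr (σ : Store) (a i j : ℕ) (v : ℝ) (a' i' j' : ℕ) :
    (σ.setRealArr a i j v).realArr a' i' j' =
      if a' = a ∧ i' = i ∧ j' = j then v else σ.realArr a' i' j' := rfl

end RealRAM

/-! ### Programs of cost `O(nm)`: largest quadratic form and rank one update. -/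

namespace RealRAM
open Finset

/-- Accumulate in the real variable `2` the sum of `e` over the values of the variable `4` below the
variable `0`. -/
def dot (e : RExp) : Program :=
  .seq (.setReal 2 (.ofNat (.const 0))) (loop 4 0 (.setReal 2 (.add (.var 2) e)))

theorem wp_dot {e : RExp} {σ : Store} (f : ℕ → ℝ)
    (he : ∀ l < σ.natVar 0, ∀ τ, Frame (dot e) σ τ → τ.natVar 4 = l → e.eval τ = f l) :
    wp (dot e) σ fun t τ => t ≤ σ.natVar 0 * (e.cost + 11) + 9 ∧
      τ.realVar 2 = ∑ l ∈ range (σ.natVar 0), f l := by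
  apply wp_seq
  apply wp_setReal
  have h0 : Frame (.setReal 2 (.ofNat (.const 0))) σ (σ.setReal 2 0) := by
    simpa [RExp.eval, NExp.eval] using (Exec.setReal 2 (.ofNat (.const 0)) σ).frame
  refine (wp_loop (T := e.cost + 3) (fun i τ => τ.realVar 2 = ∑ l ∈ range i, f l)
    (by simp [Program.natVars]) (by simp [Program.natVars]) (by decide)
    (by simp [RExp.eval, NExp.eval]) ?_).mono ?_
  · intro i hi τ hF hτ hI
    apply wp_setReal
    have : e.eval τ = f i := by
      refine he i (by simpa using hi) τ ?_ hτ
      simp only [RExp.eval, NExp.eval, Nat.cast_zero] at hF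
      exact h0.seqLeft.trans hF.seqRight
    simp only [RExp.cost, RExp.eval, this, sum_range_succ, setNat_realVar, setReal_realVar, if_pos,
      hI, and_true]
    omega
  · rintro t τ _ ⟨ht, h⟩
    simp only [setReal_natVar] at ht h
    refine ⟨?_, h⟩
    simp only [RExp.cost, NExp.cost]
    linarith

/-- Assign `e` to the entries of row `r` (a variable) of the array `A`; the variable `3` runs
through the columns. -/
def rowLoop (A r : ℕ) (e : RExp) : Program := loop 3 1 (.setRealArr A (.var r) (.var 3) e)

/-- The expression may read the array being overwritten: when column `i` is computed, the other rows
and the columns from `i` on still hold their old values. -/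
theorem wp_rowLoop {A r : ℕ} {e : RExp} {σ : Store} (hr : r ≠ 3) (f : ℕ → ℝ)
    (he : ∀ i < σ.natVar 1, ∀ τ, Frame (rowLoop A r e) σ τ → τ.natVar 3 = i →
      (∀ l' i', (l' ≠ σ.natVar r ∨ i ≤ i') → τ.realArr A l' i' = σ.realArr A l' i') →
      e.eval τ = f i) :
    wp (rowLoop A r e) σ fun t τ => t ≤ σ.natVar 1 * (e.cost + 11) + 6 ∧
      ∀ l' i', τ.realArr A l' i' =
        if l' = σ.natVar r ∧ i' < σ.natVar 1 then f i' else σ.realArr A l' i' := by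
  refine (wp_loop (T := e.cost + 3) (fun i τ => ∀ l' i', τ.realArr A l' i' =
        if l' = σ.natVar r ∧ i' < i then f i' else σ.realArr A l' i')
    (by simp [Program.natVars]) (by simp [Program.natVars]) (by decide) (by simp) ?_).mono ?_
  · intro i hi τ hF hτ hI
    apply wp_setRealArr
    have h1 : e.eval τ = f i := by
      refine he i hi τ hF hτ fun l' i' h => ?_
      rw [hI, if_neg]
      rintro ⟨h1, h2⟩
      rcases h with h | h
      · exact h h1
      · omega
    have h2 : τ.natVar r = σ.natVar r := hF.natVar r (by simp [Program.natVars, loop, hr])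
    simp only [NExp.cost, NExp.eval, h1, hτ, h2, setNat_realArr, setRealArr_realArr, true_and, hI]
    refine ⟨by omega, fun l' i' => ?_⟩
    split_ifs <;> first | rfl | omega | grind
  · rintro t τ _ ⟨ht, h⟩
    exact ⟨by linarith, h⟩

/-- Find the unflagged column with the largest value of `∑ l, W l i * Y l i`. -/
def argmax : Program :=
  .seq (.setReal 1 (.sub (.ofNat (.const 0)) (.ofNat (.const 1))))
    (loop 3 1 (.seq (dot (.mul (.arr 0 (.var 4) (.var 3)) (.arr 1 (.var 4) (.var 3))))
      (.ite (.and (.natLt (.arr 1 (.var 3)) (.const 1)) (.realLt (.var 1) (.var 2)))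
        (.seq (.setReal 1 (.var 2)) (.setNat 5 (.var 3))) .skip)))

theorem wp_argmax {σ : Store} {d : ℕ → ℝ} (hm : 1 ≤ σ.natVar 0) (hn : 1 ≤ σ.natVar 1)
    (hd : ∀ i < σ.natVar 1,
      d i = ∑ l ∈ range (σ.natVar 0), σ.realArr 0 l i * σ.realArr 1 l i)
    (hd0 : ∀ i < σ.natVar 1, 0 ≤ d i) (hf : ∃ i < σ.natVar 1, σ.natArr 1 i = 0) :
    wp argmax σ fun t τ => t ≤ 100 * (σ.natVar 1 * σ.natVar 0) ∧
      τ.natVar 5 < σ.natVar 1 ∧ σ.natArr 1 (τ.natVar 5) = 0 ∧ τ.realVar 1 = d (τ.natVar 5) ∧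
      ∀ i < σ.natVar 1, σ.natArr 1 i = 0 → d i ≤ d (τ.natVar 5) := by
  apply wp_seq
  apply wp_setReal
  -- The running maximum starts at `-1`, below every `d i`, so the first unflagged column is always
  -- taken; the left alternative says that none has been met yet.
  refine (wp_loop (T := σ.natVar 0 * 18 + 30)
    (fun i τ => (τ.realVar 1 = -1 ∧ ∀ i' < i, σ.natArr 1 i' ≠ 0) ∨
      (τ.natVar 5 < i ∧ σ.natArr 1 (τ.natVar 5) = 0 ∧ τ.realVar 1 = d (τ.natVar 5) ∧
      ∀ i' < i, σ.natArr 1 i' = 0 → d i' ≤ d (τ.natVar 5)))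
    (by decide) (by decide) (by decide) (by left; simp [RExp.eval, NExp.eval]) ?_).mono ?_
  · intro i hi τ hF hτ hI
    have hm' := hF.natVar 0 (by decide)
    have hfl := hF.natArr 1 (by decide)
    have hW := hF.realArr 0 (by decide)
    have hY := hF.realArr 1 (by decide)
    simp only [setReal_natVar, setReal_natArr, setReal_realArr] at hi hm' hfl hW hY
    apply wp_seq
    refine (wp_dot (fun l => σ.realArr 0 l i * σ.realArr 1 l i) ?_).mono ?_
    · intro l hl υ hFυ hυ
      have h3 := hFυ.natVar 3 (by decide)
      have h0 := hFυ.realArr 0 (by decide)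
      have h1 := hFυ.realArr 1 (by decide)
      simp [RExp.eval, NExp.eval, hυ, h3, h0, h1, hτ, hW, hY]
    · rintro t υ hFυ ⟨ht, hs⟩
      rw [hm', ← hd i hi] at hs
      have h3 := hFυ.natVar 3 (by decide)
      have h5 := hFυ.natVar 5 (by decide)
      have h1 := hFυ.realVar 1 (by decide)
      have hfl' := hFυ.natArr 1 (by decide)
      have hdi := hd0 i hi
      simp only [RExp.cost, NExp.cost, hm'] at ht
      apply wp_ite
      · intro hb
        simp only [BExp.eval, NExp.eval, RExp.eval, hfl', hfl, h3, hτ, h1, hs] at hb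
        apply wp_seq
        apply wp_setReal
        apply wp_setNat
        simp only [BExp.cost, RExp.cost, NExp.cost, RExp.eval, NExp.eval, setReal_natVar,
          setNat_natVar, setNat_realVar, setReal_realVar, if_pos, hs, h3, hτ]
        refine ⟨by omega, Or.inr ⟨by simp, by simp; omega, by simp, fun i' hi' hz => ?_⟩⟩
        simp only [Nat.reduceEqDiff, if_false]
        rcases Nat.lt_succ_iff_lt_or_eq.1 hi' with h | h
        · rcases hI with ⟨_, hI⟩ | ⟨_, _, hI1, hI2⟩
          · exact absurd hz (hI i' h)
          · exact (hI2 i' h hz).trans (hI1 ▸ hb.2.le)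
        · rw [h]
      · intro hb
        simp only [BExp.eval, NExp.eval, RExp.eval, hfl', hfl, h3, hτ, h1, hs, not_and,
          not_lt] at hb
        apply wp_skip
        simp only [BExp.cost, RExp.cost, NExp.cost, setNat_natVar, setNat_realVar, h1, h5]
        refine ⟨by omega, ?_⟩
        simp only [Nat.reduceEqDiff, if_false]
        rcases hI with ⟨hI1, hI⟩ | ⟨hI0, hI', hI1, hI2⟩
        · refine Or.inl ⟨hI1, fun i' hi' => ?_⟩
          rcases Nat.lt_succ_iff_lt_or_eq.1 hi' with h | h
          · exact hI i' h
          · intro hz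
            rw [h] at hz
            have := hb (by omega)
            linarith
        · refine Or.inr ⟨by omega, hI', hI1, fun i' hi' hz => ?_⟩
          rcases Nat.lt_succ_iff_lt_or_eq.1 hi' with h | h
          · exact hI2 i' h hz
          · rw [h] at hz ⊢
            rw [← hI1]
            exact hb (by omega)
  · rintro t τ _ ⟨ht, h⟩
    simp only [setReal_natVar] at ht h
    refine ⟨?_, ?_⟩
    · simp only [RExp.cost, NExp.cost]
      nlinarith
    · rcases h with ⟨_, h⟩ | h
      · obtain ⟨i, hi, hz⟩ := hf
        exact absurd hz (h i hi)
      · exact h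

/-- Rank one update `Y := a (Y - b Y_j G)` with `G = W_jᵀ Y`, where `j` is the variable `5`. -/
def update : Program :=
  .seq
    (loop 3 1 (.seq (dot (.mul (.arr 0 (.var 4) (.var 5)) (.arr 1 (.var 4) (.var 3))))
      (.setRealArr 3 (.const 0) (.var 3) (.var 2))))
    (loop 4 0 (.seq (.setReal 5 (.arr 1 (.var 4) (.var 5)))
      (rowLoop 1 4 (.mul (.var 3) (.sub (.arr 1 (.var 4) (.var 3))
        (.mul (.mul (.var 4) (.var 5)) (.arr 3 (.const 0) (.var 3))))))))

/-- If array `0` holds `W` and array `1` holds `B W` with `B` symmetric, this replaces `B` by a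
multiple of a rank one modification without ever storing `B`. -/
theorem wp_update {σ : Store} {g : ℕ → ℝ} (hm : 1 ≤ σ.natVar 0) (hn : 1 ≤ σ.natVar 1)
    (hj : σ.natVar 5 < σ.natVar 1)
    (hg : ∀ i < σ.natVar 1,
      g i = ∑ l ∈ range (σ.natVar 0), σ.realArr 0 l (σ.natVar 5) * σ.realArr 1 l i) :
    wp update σ fun t τ => t ≤ 200 * (σ.natVar 1 * σ.natVar 0) ∧
      (∀ i < σ.natVar 1, τ.realArr 3 0 i = g i) ∧
      ∀ l < σ.natVar 0, ∀ i < σ.natVar 1, τ.realArr 1 l i =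
        σ.realVar 3 * (σ.realArr 1 l i - σ.realVar 4 * σ.realArr 1 l (σ.natVar 5) * g i) := by
  apply wp_seq
  refine (wp_loop (T := σ.natVar 0 * 18 + 30)
    (fun i τ => ∀ i' < i, τ.realArr 3 0 i' = g i')
    (by decide) (by decide) (by decide) (by simp) ?_).mono ?_
  · intro i hi τ hF hτ hI
    have hm' := hF.natVar 0 (by decide)
    have h5 := hF.natVar 5 (by decide)
    have hW := hF.realArr 0 (by decide)
    have hY := hF.realArr 1 (by decide)
    apply wp_seq
    refine (wp_dot (fun l => σ.realArr 0 l (σ.natVar 5) * σ.realArr 1 l i) ?_).mono ?_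
    · intro l hl υ hFυ hυ
      have h3 := hFυ.natVar 3 (by decide)
      have h5' := hFυ.natVar 5 (by decide)
      have h0 := hFυ.realArr 0 (by decide)
      have h1 := hFυ.realArr 1 (by decide)
      simp [RExp.eval, NExp.eval, hυ, h3, h0, h1, hτ, hW, hY, h5, h5']
    · rintro t υ hFυ ⟨ht, hs⟩
      rw [hm', ← hg i hi] at hs
      have h3 := hFυ.natVar 3 (by decide)
      have h1 := hFυ.realArr 3 (by decide)
      simp only [RExp.cost, NExp.cost, hm'] at ht
      apply wp_setRealArr
      simp only [RExp.cost, NExp.cost, RExp.eval, NExp.eval, h3, hτ, hs, setNat_realArr,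
        setRealArr_realArr, true_and, h1]
      refine ⟨by omega, fun i' hi' => ?_⟩
      split_ifs with h
      · rw [h]
      · exact hI i' (by omega)
  · rintro t τ hF ⟨ht, hG⟩
    have hm' := hF.natVar 0 (by decide)
    have hn' := hF.natVar 1 (by decide)
    have h5 := hF.natVar 5 (by decide)
    have hY := hF.realArr 1 (by decide)
    have ha := hF.realVar 3 (by decide)
    have hb := hF.realVar 4 (by decide)
    refine (wp_loop (T := σ.natVar 1 * 24 + 20)
      (fun k υ => ∀ l i, i < σ.natVar 1 → υ.realArr 1 l i = if l < k then
        σ.realVar 3 * (σ.realArr 1 l i - σ.realVar 4 * σ.realArr 1 l (σ.natVar 5) * g i)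
        else σ.realArr 1 l i)
      (by decide) (by decide) (by decide) (by simp [hY]) ?_).mono ?_
    · intro k hk υ hFυ hυ hI
      have hn'' := hFυ.natVar 1 (by decide)
      have h5' := hFυ.natVar 5 (by decide)
      have ha' := hFυ.realVar 3 (by decide)
      have hb' := hFυ.realVar 4 (by decide)
      have hG' := hFυ.realArr 3 (by decide)
      rw [hn'] at hn''
      rw [h5] at h5'
      rw [ha] at ha'
      rw [hb] at hb'
      apply wp_seq
      -- The entry in the pivot column is saved first, since the row loop overwrites it.
      apply wp_setReal
      simp only [RExp.eval, NExp.eval, hυ, h5', RExp.cost, NExp.cost]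
      refine (wp_rowLoop (by decide) (fun i =>
        σ.realVar 3 * (σ.realArr 1 k i - σ.realVar 4 * υ.realArr 1 k (σ.natVar 5) * g i)) ?_).mono
        ?_
      · intro i hi ω hFω hω hrow
        have e1 := hFω.natVar 4 (by decide)
        have e2 := hFω.realVar 3 (by decide)
        have e3 := hFω.realVar 4 (by decide)
        have e4 := hFω.realVar 5 (by decide)
        have e5 := hFω.realArr 3 (by decide)
        simp only [setReal_natVar, setReal_realVar, setReal_realArr, hn''] at hi e1 e2 e3 e4 e5 hrow
        have e6 := hrow k i (Or.inr le_rfl)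
        rw [hI k i hi, if_neg (lt_irrefl k)] at e6
        simp only [RExp.eval, NExp.eval, e1, e2, e3, e4, e5, hω, hυ, e6, ha', hb', hG', hG i hi]
        simp
      · rintro u ω hFω ⟨hu, hω⟩
        simp only [setReal_natVar, hn'', hυ, setReal_realArr, RExp.cost, NExp.cost] at hu hω
        refine ⟨by omega, fun l i hi => ?_⟩
        simp only [setNat_realArr, hω]
        by_cases hl : l = k
        · subst hl
          rw [if_pos ⟨rfl, hi⟩, if_pos (Nat.lt_succ_self l)]
          rw [hI l _ hj, if_neg (lt_irrefl l)]
        · rw [if_neg (fun h => hl h.1), hI l i hi]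
          grind
    · rintro u υ hFυ ⟨hu, hI⟩
      have hG' := hFυ.realArr 3 (by decide)
      rw [hm'] at hI hu
      refine ⟨by nlinarith, fun i hi => by rw [hG', hG i hi], fun l hl i hi => ?_⟩
      rw [hI l i hi, if_pos hl]

end RealRAM

/-! ### Programs for a change of coordinates and for one pivot step. -/

namespace RealRAM
open Finset

/-- Copy the real array `src` to the array `0`, and its multiple by the variable `3` to the
array `1`. -/
def rescale (src : ℕ) : Program :=
  loop 4 0 (.seq (rowLoop 0 4 (.arr src (.var 4) (.var 3)))
    (rowLoop 1 4 (.mul (.var 3) (.arr 0 (.var 4) (.var 3)))))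

theorem wp_rescale {src : ℕ} {σ : Store} (hs : src ≠ 1) (hm : 1 ≤ σ.natVar 0)
    (hn : 1 ≤ σ.natVar 1) :
    wp (rescale src) σ fun t τ => t ≤ 100 * (σ.natVar 1 * σ.natVar 0) ∧
      ∀ l < σ.natVar 0, ∀ i < σ.natVar 1, τ.realArr 0 l i = σ.realArr src l i ∧
        τ.realArr 1 l i = σ.realVar 3 * σ.realArr src l i := by
  refine (wp_loop (T := σ.natVar 1 * 40 + 20)
    (fun k τ => (∀ l, k ≤ l → τ.realArr src l = σ.realArr src l) ∧
      ∀ l < k, ∀ i < σ.natVar 1, τ.realArr 0 l i = σ.realArr src l i ∧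
        τ.realArr 1 l i = σ.realVar 3 * σ.realArr src l i)
    (by simp [Program.natVars, rowLoop, loop]) (by simp [Program.natVars, rowLoop, loop])
    (by decide) (by simp) ?_).mono ?_
  · intro k hk τ hF hτ hI
    have hn' : τ.natVar 1 = σ.natVar 1 :=
      hF.natVar 1 (by simp [Program.natVars, rowLoop, loop])
    have hv : τ.realVar 3 = σ.realVar 3 :=
      hF.realVar 3 (by simp [Program.realVars, rowLoop, loop])
    apply wp_seq
    refine (wp_rowLoop (by decide) (σ.realArr src k) ?_).mono ?_
    · intro i hi υ hFυ hυ hrow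
      have h4 : υ.natVar 4 = τ.natVar 4 := hFυ.natVar 4 (by simp [Program.natVars, rowLoop, loop])
      simp only [RExp.eval, NExp.eval, h4, hυ, hτ]
      -- For `src = 0` the array is copied onto itself, and the entry read still has its old value.
      by_cases h0 : src = 0
      · subst h0
        rw [hrow k i (Or.inr le_rfl), hI.1 k le_rfl]
      · rw [hFυ.realArr src (by simp [Program.realArrs, rowLoop, loop, h0]), hI.1 k le_rfl]
    · rintro t υ hFυ ⟨ht, hυ⟩
      have h4 : υ.natVar 4 = τ.natVar 4 := hFυ.natVar 4 (by simp [Program.natVars, rowLoop, loop])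
      have h1 : υ.natVar 1 = τ.natVar 1 := hFυ.natVar 1 (by simp [Program.natVars, rowLoop, loop])
      have h3 : υ.realVar 3 = τ.realVar 3 :=
        hFυ.realVar 3 (by simp [Program.realVars, rowLoop, loop])
      have hA1 : υ.realArr 1 = τ.realArr 1 :=
        hFυ.realArr 1 (by simp [Program.realArrs, rowLoop, loop])
      refine (wp_rowLoop (by decide) (fun i => σ.realVar 3 * σ.realArr src k i) ?_).mono ?_
      · intro i hi ω hFω hω hrow
        rw [h1, hn'] at hi
        have e4 : ω.natVar 4 = υ.natVar 4 :=
          hFω.natVar 4 (by simp [Program.natVars, rowLoop, loop])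
        have e3 : ω.realVar 3 = υ.realVar 3 :=
          hFω.realVar 3 (by simp [Program.realVars, rowLoop, loop])
        have e0 : ω.realArr 0 = υ.realArr 0 :=
          hFω.realArr 0 (by simp [Program.realArrs, rowLoop, loop])
        simp only [RExp.eval, NExp.eval, e4, e3, e0, h4, h3, hω, hτ, hυ, hn', hi, hv, and_self,
          if_true]
      · rintro u ω hFω ⟨hu, hω⟩
        have e0 : ω.realArr 0 = υ.realArr 0 :=
          hFω.realArr 0 (by simp [Program.realArrs, rowLoop, loop])
        simp only [RExp.cost, NExp.cost, h1, hn', h4, hτ] at ht hu hω hυ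
        refine ⟨by omega, fun l hl => ?_, fun l hl i hi => ?_⟩
        · simp only [setNat_realArr]
          rw [← hI.1 l (by omega)]
          by_cases h0 : src = 0
          · subst h0
            rw [e0]
            funext i
            rw [hυ, if_neg (by omega)]
          · rw [hFω.realArr src (by simp [Program.realArrs, rowLoop, loop, hs]),
              hFυ.realArr src (by simp [Program.realArrs, rowLoop, loop, h0])]
        · simp only [setNat_realArr, e0, hυ, hω, hA1]
          rcases Nat.lt_succ_iff_lt_or_eq.1 hl with h | h
          · rw [if_neg (by omega), if_neg (by omega)]
            exact hI.2 l h i hi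
          · subst h
            simp [hi]
  · rintro t τ _ ⟨ht, h⟩
    exact ⟨by nlinarith, h.2⟩

/-- One step of Gram–Schmidt orthogonalization with pivoting, together with one step of Gauss–Jordan
elimination on the rows of the array `2`. -/
def pivotStep : Program :=
  .seq argmax (.seq (.setNatArr 0 (.var 6) (.var 5)) (.seq (.setReal 3 (.ofNat (.const 1)))
    (.seq (.setReal 4 (.div (.ofNat (.const 1)) (.var 1))) (.seq update
      (.seq (rowLoop 2 6 (.mul (.var 4) (.arr 3 (.const 0) (.var 3))))
        (loop 4 6 (.seq (.setReal 5 (.arr 2 (.var 4) (.var 5)))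
          (rowLoop 2 4 (.sub (.arr 2 (.var 4) (.var 3))
            (.mul (.var 5) (.arr 2 (.var 6) (.var 3))))))))))))

/-- Used with array `1` equal to `P W`, where `P` is the projected form. Chosen columns are not
flagged: `P` annihilates them, so they cannot be the positive maximum again. -/
theorem wp_pivotStep {σ : Store} {d : ℕ → ℝ} {g : ℕ → ℕ → ℝ} (ht : σ.natVar 6 < σ.natVar 0)
    (hn : 1 ≤ σ.natVar 1)
    (hd : ∀ i < σ.natVar 1,
      d i = ∑ l ∈ range (σ.natVar 0), σ.realArr 0 l i * σ.realArr 1 l i)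
    (hg : ∀ j < σ.natVar 1, ∀ i < σ.natVar 1,
      g j i = ∑ l ∈ range (σ.natVar 0), σ.realArr 0 l j * σ.realArr 1 l i)
    (hd0 : ∀ i < σ.natVar 1, 0 ≤ d i) (hf : ∀ i < σ.natVar 1, σ.natArr 1 i = 0) :
    wp pivotStep σ fun t τ => t ≤ 500 * (σ.natVar 1 * σ.natVar 0) ∧ ∃ j < σ.natVar 1,
      (∀ i < σ.natVar 1, d i ≤ d j) ∧
      τ.natArr 0 = Function.update (σ.natArr 0) (σ.natVar 6) j ∧
      (∀ l < σ.natVar 0, ∀ i < σ.natVar 1, τ.realArr 1 l i =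
        σ.realArr 1 l i - 1 / d j * σ.realArr 1 l j * g j i) ∧
      (∀ i < σ.natVar 1, τ.realArr 2 (σ.natVar 6) i = 1 / d j * g j i) ∧
      (∀ l < σ.natVar 6, ∀ i < σ.natVar 1, τ.realArr 2 l i =
        σ.realArr 2 l i - σ.realArr 2 l j * (1 / d j * g j i)) := by
  have hm : 1 ≤ σ.natVar 0 := by omega
  apply wp_seq
  refine (wp_argmax hm hn hd hd0 ⟨0, hn, hf 0 hn⟩).mono ?_
  rintro t1 τ hF ⟨ht1, hj, hfj, hκ, hmax⟩
  have f0 := hF.natVar 0 (by decide)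
  have f1 := hF.natVar 1 (by decide)
  have f6 := hF.natVar 6 (by decide)
  have fW := hF.realArr 0 (by decide)
  have fY := hF.realArr 1 (by decide)
  have fR := hF.realArr 2 (by decide)
  have fS := hF.natArr 0 (by decide)
  obtain ⟨j, hjeq⟩ : ∃ j, τ.natVar 5 = j := ⟨_, rfl⟩
  rw [hjeq] at hj hfj hκ hmax
  have hmax' : ∀ i < σ.natVar 1, d i ≤ d j := fun i hi => hmax i hi (hf i hi)
  apply wp_seq
  apply wp_setNatArr
  apply wp_seq
  apply wp_setReal
  apply wp_seq
  apply wp_setReal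
  apply wp_seq
  simp only [NExp.eval, RExp.eval, f6, hjeq, NExp.cost, RExp.cost, setReal_realVar,
    setNatArr_realVar, Nat.reduceEqDiff, if_false, hκ, Nat.cast_one]
  generalize hτ' : ((τ.setNatArr 0 (σ.natVar 6) j).setReal 3 1).setReal 4 (1 / d j) = τ'
  have e0 : τ'.natVar 0 = σ.natVar 0 := by simp [← hτ', f0]
  have e1 : τ'.natVar 1 = σ.natVar 1 := by simp [← hτ', f1]
  have e6 : τ'.natVar 6 = σ.natVar 6 := by simp [← hτ', f6]
  have e5 : τ'.natVar 5 = j := by simp [← hτ', hjeq]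
  have eW : τ'.realArr 0 = σ.realArr 0 := by simp [← hτ', fW]
  have eY : τ'.realArr 1 = σ.realArr 1 := by simp [← hτ', fY]
  have eR : τ'.realArr 2 = σ.realArr 2 := by simp [← hτ', fR]
  have eS : τ'.natArr 0 = Function.update (σ.natArr 0) (σ.natVar 6) j := by
    funext i
    simp [← hτ', fS, Function.update_apply]
  have e3 : τ'.realVar 3 = 1 := by simp [← hτ']
  have e4 : τ'.realVar 4 = 1 / d j := by simp [← hτ']
  refine (wp_update (g := g j) (by omega) (by omega) (by omega) ?_).mono ?_
  · intro i hi
    rw [e0, e5, eW, eY]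
    exact hg j hj i (by omega)
  rintro t2 υ hF2 ⟨ht2, hG, hY'⟩
  simp only [e0, e1, e3, e4, e5, eY, one_mul] at ht2 hG hY'
  have f1 := hF2.natVar 1 (by decide)
  have f5 := hF2.natVar 5 (by decide)
  have f6 := hF2.natVar 6 (by decide)
  have f4 := hF2.realVar 4 (by decide)
  have fR := hF2.realArr 2 (by decide)
  have fS := hF2.natArr 0 (by decide)
  rw [e1] at f1
  rw [e5] at f5
  rw [e6] at f6
  rw [e4] at f4
  rw [eR] at fR
  rw [eS] at fS
  apply wp_seq
  refine (wp_rowLoop (by decide) (fun i => 1 / d j * g j i) ?_).mono ?_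
  · intro i hi ω hFω hω _
    have g4 := hFω.realVar 4 (by decide)
    have gG := hFω.realArr 3 (by decide)
    simp only [RExp.eval, NExp.eval, g4, f4, gG, hω, hG i (by omega)]
  rintro t3 ω hF3 ⟨ht3, hR⟩
  have g1 := hF3.natVar 1 (by decide)
  have g5 := hF3.natVar 5 (by decide)
  have g6 := hF3.natVar 6 (by decide)
  have gY := hF3.realArr 1 (by decide)
  have gS := hF3.natArr 0 (by decide)
  rw [f1] at g1
  rw [f5] at g5
  rw [f6] at g6
  rw [fS] at gS
  simp only [f1, f6, fR, RExp.cost, NExp.cost] at hR ht3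
  -- Gauss–Jordan clears the pivot column in the earlier rows only; later rows are not yet
  -- meaningful.
  refine (wp_loop (T := σ.natVar 1 * 30 + 20)
    (fun k ρ => ∀ l, ∀ i < σ.natVar 1, ρ.realArr 2 l i =
      if l < k then σ.realArr 2 l i - σ.realArr 2 l j * (1 / d j * g j i) else ω.realArr 2 l i)
    (by decide) (by decide) (by decide) (by simp) ?_).mono ?_
  · intro k hk ρ hFρ hρ hI
    have h1 := hFρ.natVar 1 (by decide)
    have h5 := hFρ.natVar 5 (by decide)
    have h6 := hFρ.natVar 6 (by decide)
    rw [g1] at h1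
    rw [g5] at h5
    rw [g6] at h6
    rw [g6] at hk
    apply wp_seq
    apply wp_setReal
    simp only [RExp.eval, NExp.eval, hρ, h5, RExp.cost, NExp.cost]
    refine (wp_rowLoop (by decide)
      (fun i => σ.realArr 2 k i - σ.realArr 2 k j * (1 / d j * g j i)) ?_).mono ?_
    · intro i hi χ hFχ hχ hrow
      have c4 := hFχ.natVar 4 (by decide)
      have c6 := hFχ.natVar 6 (by decide)
      have c5 := hFχ.realVar 5 (by decide)
      simp only [setReal_natVar, setReal_realVar, setReal_realArr, hρ, h6, h1, if_pos]
        at c4 c6 c5 hrow hi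
      have r1 := hrow k i (Or.inr le_rfl)
      have r2 := hrow (σ.natVar 6) i (Or.inl (by omega))
      rw [hI k i hi, if_neg (lt_irrefl k), hR, if_neg (by omega)] at r1
      rw [hI _ i hi, if_neg (by omega), hR, if_pos ⟨rfl, hi⟩] at r2
      rw [hI k j hj, if_neg (lt_irrefl k), hR, if_neg (by omega)] at c5
      simp only [RExp.eval, NExp.eval, c4, c6, c5, hχ, r1, r2]
    · rintro u χ hFχ ⟨hu, hχ⟩
      simp only [setReal_natVar, h1, hρ, setReal_realArr, RExp.cost, NExp.cost] at hu hχ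
      refine ⟨by omega, fun l i hi => ?_⟩
      simp only [setNat_realArr, hχ]
      by_cases hl : l = k
      · subst hl
        rw [if_pos ⟨rfl, hi⟩, if_pos (Nat.lt_succ_self l)]
      · rw [if_neg (fun h => hl h.1), hI l i hi]
        grind
  · rintro t4 ρ hF4 ⟨ht4, hI⟩
    rw [g6] at ht4 hI
    have p1 := hF4.realArr 1 (by decide)
    have pS := hF4.natArr 0 (by decide)
    rw [gY] at p1
    rw [gS] at pS
    refine ⟨?_, j, hj, hmax', pS, ?_, ?_, ?_⟩
    · have : σ.natVar 6 * (σ.natVar 1 * 30 + 28) ≤ σ.natVar 0 * (σ.natVar 1 * 30 + 28) :=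
        Nat.mul_le_mul_right _ ht.le
      nlinarith
    · intro l hl i hi
      rw [p1]
      exact hY' l hl i hi
    · intro i hi
      rw [hI _ i hi, if_neg (lt_irrefl _), hR, if_pos ⟨rfl, hi⟩]
    · intro l hl i hi
      rw [hI _ i hi, if_pos hl]

end RealRAM

/-! ### Moment matrices, determinant bounds and rank one modifications. -/

namespace Matrix
open Finset

variable {m n : ℕ}

/-- The weighted second moment matrix `∑ i, q i • w_i w_iᵀ` of the columns `w_i` of `W`. -/
def moment (W : Matrix (Fin m) (Fin n) ℝ) (q : Fin n → ℝ) : Matrix (Fin m) (Fin m) ℝ :=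
  W * diagonal q * Wᵀ

/-- The values `w_iᵀ B w_j` of a bilinear form at the columns of `W`. -/
def columnForm (W : Matrix (Fin m) (Fin n) ℝ) (B : Matrix (Fin m) (Fin m) ℝ) :
    Matrix (Fin n) (Fin n) ℝ :=
  Wᵀ * (B * W)

theorem columnForm_apply (W : Matrix (Fin m) (Fin n) ℝ) (B : Matrix (Fin m) (Fin m) ℝ) (i j : Fin n) :
    columnForm W B i j = W.col i ⬝ᵥ (B *ᵥ W.col j) := rfl

theorem moment_mul (T : Matrix (Fin m) (Fin m) ℝ) (W : Matrix (Fin m) (Fin n) ℝ)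
    (q : Fin n → ℝ) : moment (T * W) q = T * moment W q * Tᵀ := by
  simp only [moment, transpose_mul, Matrix.mul_assoc]

theorem det_moment_mul (T : Matrix (Fin m) (Fin m) ℝ) (W : Matrix (Fin m) (Fin n) ℝ)
    (q : Fin n → ℝ) : (moment (T * W) q).det = T.det ^ 2 * (moment W q).det := by
  rw [moment_mul, det_mul, det_mul, det_transpose]; ring

theorem moment_add (W : Matrix (Fin m) (Fin n) ℝ) (p q : Fin n → ℝ) :
    moment W (p + q) = moment W p + moment W q := by
  rw [moment, show diagonal (p + q) = diagonal p + diagonal q from (diagonal_add p q).symm,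
    Matrix.mul_add, Matrix.add_mul]
  rfl

theorem moment_smul (W : Matrix (Fin m) (Fin n) ℝ) (a : ℝ) (q : Fin n → ℝ) :
    moment W (a • q) = a • moment W q := by
  rw [moment, diagonal_smul, Matrix.mul_smul, Matrix.smul_mul]; rfl

theorem moment_single (W : Matrix (Fin m) (Fin n) ℝ) (j : Fin n) :
    moment W (Pi.single j 1) = vecMulVec (W.col j) (W.col j) := by
  ext a b
  simp [moment, mul_apply, diagonal_apply, vecMulVec_apply, Pi.single_apply]

theorem moment_posSemidef (W : Matrix (Fin m) (Fin n) ℝ) {q : Fin n → ℝ} (hq : 0 ≤ q) :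
    (moment W q).PosSemidef := by
  have := (PosSemidef.diagonal hq).mul_mul_conjTranspose_same W
  rwa [conjTranspose_eq_transpose_of_trivial] at this

theorem trace_mul_moment (B : Matrix (Fin m) (Fin m) ℝ) (W : Matrix (Fin m) (Fin n) ℝ)
    (q : Fin n → ℝ) : (B * moment W q).trace = ∑ i, q i * columnForm W B i i := by
  rw [moment, ← Matrix.mul_assoc, trace_mul_comm, ← Matrix.mul_assoc, ← Matrix.mul_assoc, columnForm,
    ← Matrix.mul_assoc, trace]
  simp only [diag_apply, mul_diagonal, mul_comm]

/-- The determinant of a positive semidefinite matrix is at most the `m`-th power of the mean of its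
eigenvalues. -/
theorem PosSemidef.det_le_trace_pow {A : Matrix (Fin m) (Fin m) ℝ} (hA : A.PosSemidef)
    (hm : 0 < m) : A.det ≤ (A.trace / m) ^ m := by
  have h0 := hA.eigenvalues_nonneg
  have hm' : (m : ℝ) ≠ 0 := by positivity
  have hd := hA.1.det_eq_prod_eigenvalues
  have ht := hA.1.trace_eq_sum_eigenvalues
  simp only [RCLike.ofReal_real_eq_id, id_eq] at hd ht
  have h := Real.geom_mean_le_arith_mean_weighted univ (fun _ => (m : ℝ)⁻¹) hA.1.eigenvalues
    (fun _ _ => by positivity) (by simp [hm']) fun i _ => h0 i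
  rw [Real.finsetProd_rpow _ _ fun i _ => h0 i, ← hd, ← mul_sum, ← ht] at h
  have hdet : 0 ≤ A.det := hd ▸ prod_nonneg fun i _ => h0 i
  calc A.det = (A.det ^ (m : ℝ)⁻¹) ^ m := (Real.rpow_inv_natCast_pow hdet hm.ne').symm
    _ ≤ _ := pow_le_pow_left₀ (by positivity) (h.trans_eq (by ring)) m

open scoped MatrixOrder in
theorem PosSemidef.exists_eq_transpose_mul_self {B : Matrix (Fin m) (Fin m) ℝ}
    (hB : B.PosSemidef) : ∃ C : Matrix (Fin m) (Fin m) ℝ, B = Cᵀ * C := by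
  obtain ⟨C, hC⟩ := CStarAlgebra.nonneg_iff_eq_star_mul_self.1 hB.nonneg
  exact ⟨C, by rw [hC, star_eq_conjTranspose, conjTranspose_eq_transpose_of_trivial]⟩

/-- With `B = Cᵀ C`, this is AM–GM for the eigenvalues of `C M Cᵀ`, whose trace is that of `B M`. -/
theorem det_mul_det_le {B M : Matrix (Fin m) (Fin m) ℝ} (hB : B.PosSemidef) (hM : M.PosSemidef)
    (hm : 0 < m) : B.det * M.det ≤ ((B * M).trace / m) ^ m := by
  obtain ⟨C, rfl⟩ := hB.exists_eq_transpose_mul_self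
  have h := (hM.mul_mul_conjTranspose_same C).det_le_trace_pow hm
  rw [conjTranspose_eq_transpose_of_trivial, trace_mul_comm, ← Matrix.mul_assoc] at h
  refine le_trans (le_of_eq ?_) h
  simp only [det_mul]; ring

/-- Weak duality for D-optimal design. The weight `q` is not normalized, so that it can also be the
indicator function of a column set. -/
theorem det_moment_le {W : Matrix (Fin m) (Fin n) ℝ} {B M : Matrix (Fin m) (Fin m) ℝ}
    {q : Fin n → ℝ} (hB : B.PosSemidef) (hBM : B * M = 1) (hq : 0 ≤ q) (hm : 0 < m) :
    (moment W q).det ≤ ((∑ i, q i * columnForm W B i i) / m) ^ m * M.det := by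
  have h := det_mul_det_le hB (moment_posSemidef W hq) hm
  rw [trace_mul_moment] at h
  have h1 : B.det * M.det = 1 := by rw [← det_mul, hBM, det_one]
  have h2 : 0 ≤ M.det := by
    have := hB.det_nonneg
    by_contra hc
    nlinarith
  calc (moment W q).det = (B.det * (moment W q).det) * M.det := by
        rw [mul_right_comm, h1, one_mul]
    _ ≤ _ := by gcongr

/-- The matrix determinant lemma. -/
theorem det_add_smul_vecMulVec {B M : Matrix (Fin m) (Fin m) ℝ} (hBM : B * M = 1)
    (x : Fin m → ℝ) (s : ℝ) :
    (M + s • vecMulVec x x).det = M.det * (1 + s * (x ⬝ᵥ (B *ᵥ x))) := by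
  have hu : IsUnit M.det := isUnit_det_of_left_inverse hBM
  have h := det_add_replicateCol_mul_replicateRow (ι := Unit) hu (s • x) x
  rw [← vecMulVec_eq, smul_vecMulVec] at h
  rw [h, inv_eq_left_inv hBM, Matrix.mul_assoc]
  congr 1
  rw [det_unique, add_apply, one_apply_eq, ← replicateCol_mulVec, mulVec_smul]
  simp [mul_apply, dotProduct, mul_sum, mul_left_comm]

/-- The rank one modification `B - b • (B x) (B x)ᵀ` of a symmetric matrix. -/
def downdate (B : Matrix (Fin m) (Fin m) ℝ) (x : Fin m → ℝ) (b : ℝ) : Matrix (Fin m) (Fin m) ℝ :=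
  B - b • vecMulVec (B *ᵥ x) (B *ᵥ x)

theorem transpose_downdate {B : Matrix (Fin m) (Fin m) ℝ} (hB : Bᵀ = B) (x : Fin m → ℝ) (b : ℝ) :
    (downdate B x b)ᵀ = downdate B x b := by
  rw [downdate, transpose_sub, transpose_smul, transpose_vecMulVec, hB]

theorem mulVec_dotProduct {B : Matrix (Fin m) (Fin m) ℝ} (hB : Bᵀ = B) (x y : Fin m → ℝ) :
    (B *ᵥ x) ⬝ᵥ y = x ⬝ᵥ (B *ᵥ y) := by
  rw [dotProduct_mulVec, ← mulVec_transpose, hB]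

theorem downdate_mulVec {B : Matrix (Fin m) (Fin m) ℝ} (hB : Bᵀ = B) (x y : Fin m → ℝ) (b : ℝ) :
    downdate B x b *ᵥ y = B *ᵥ y - (b * (x ⬝ᵥ (B *ᵥ y))) • (B *ᵥ x) := by
  rw [downdate, sub_mulVec, smul_mulVec, vecMulVec_mulVec, mulVec_dotProduct hB, op_smul_eq_smul, smul_smul]

theorem downdate_mul_apply {B : Matrix (Fin m) (Fin m) ℝ} (hB : Bᵀ = B)
    (W : Matrix (Fin m) (Fin n) ℝ) (j : Fin n) (b : ℝ) (l : Fin m) (i : Fin n) :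
    (downdate B (W.col j) b * W) l i =
      (B * W) l i - b * (B * W) l j * columnForm W B j i := by
  have := congrFun (downdate_mulVec hB (W.col j) (W.col i) b) l
  rw [Pi.sub_apply, Pi.smul_apply, smul_eq_mul, ← columnForm_apply] at this
  refine this.trans ?_
  rw [mul_right_comm]
  rfl

/-- The Sherman–Morrison formula. -/
theorem downdate_mul_add {B M : Matrix (Fin m) (Fin m) ℝ} (hB : Bᵀ = B) (hBM : B * M = 1)
    (x : Fin m → ℝ) {s : ℝ} (hs : 1 + s * (x ⬝ᵥ (B *ᵥ x)) ≠ 0) :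
    downdate B x (s / (1 + s * (x ⬝ᵥ (B *ᵥ x)))) * (M + s • vecMulVec x x) = 1 := by
  have h1 : vecMulVec (B *ᵥ x) (B *ᵥ x) * M = vecMulVec (B *ᵥ x) x := by
    rw [vecMulVec_mul, ← vecMul_transpose, hB, vecMul_vecMul, hBM, vecMul_one]
  have h2 : vecMulVec (B *ᵥ x) (B *ᵥ x) * vecMulVec x x =
      (x ⬝ᵥ (B *ᵥ x)) • vecMulVec (B *ᵥ x) x := by
    rw [vecMulVec_mul_vecMulVec, mulVec_dotProduct hB, vecMulVec_smul]
  rw [downdate]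
  rw [Matrix.mul_add, Matrix.sub_mul, Matrix.sub_mul, hBM, Matrix.smul_mul, Matrix.smul_mul,
    Matrix.mul_smul, Matrix.mul_smul, h1, h2, mul_vecMulVec, smul_smul, smul_smul]
  generalize x ⬝ᵥ (B *ᵥ x) = κ at *
  have : s / (1 + s * κ) + s / (1 + s * κ) * (s * κ) = s := by field_simp
  ext i j
  simp only [add_apply, sub_apply, smul_apply, smul_eq_mul]
  linear_combination -(vecMulVec (B *ᵥ x) x i j) * this

/-- A weight vector of a probability distribution. -/
def IsWeight (p : Fin n → ℝ) : Prop := 0 ≤ p ∧ ∑ i, p i = 1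

/-! ### Pivoted Gram–Schmidt orthogonalization. -/

/-- The state of pivoted Gram–Schmidt orthogonalization of the columns of `W` with respect to the
inner product `M⁻¹`, after `t` steps: `P` is the projected inner product, `s` lists the chosen
columns, the rows of `U` are the (normalized) functionals used and `κ` lists their pivots. -/
structure GramSchmidt (W : Matrix (Fin m) (Fin n) ℝ) (B M : Matrix (Fin m) (Fin m) ℝ) (t : ℕ)
    (P : Matrix (Fin m) (Fin m) ℝ) (s : Fin m → Fin n) (κ : Fin m → ℝ)
    (U : Fin m → Fin m → ℝ) : Prop where
  symm : Pᵀ = P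
  proj : P * M * P = P
  ker : ∀ l : Fin m, (l : ℕ) < t → P *ᵥ W.col (s l) = 0
  trace : (P * M).trace = m - t
  decomp : P + ∑ l, κ l • vecMulVec (U l) (U l) = B
  zero : ∀ l : Fin m, t ≤ l → U l = 0
  le_one : ∀ l i, |U l ⬝ᵥ W.col i| ≤ 1
  diag : ∀ l : Fin m, (l : ℕ) < t → U l ⬝ᵥ W.col (s l) = 1
  tri : ∀ l l' : Fin m, (l : ℕ) < t → l' < l → U l ⬝ᵥ W.col (s l') = 0
  -- The weight is quantified here because the first run has `M = 1`, which need not be the moment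
  -- matrix of a probability weight.
  pivot : ∀ l : Fin m, (l : ℕ) < t → ∀ p, IsWeight p → moment W p = M → (m : ℝ) - l ≤ κ l

section GramSchmidt

variable {W : Matrix (Fin m) (Fin n) ℝ} {B M : Matrix (Fin m) (Fin m) ℝ} {t : ℕ}
    {P : Matrix (Fin m) (Fin m) ℝ} {s : Fin m → Fin n} {κ : Fin m → ℝ}
    {U : Fin m → Fin m → ℝ}

theorem GramSchmidt.init (hB : Bᵀ = B) (hBM : B * M = 1) (s : Fin m → Fin n) (κ : Fin m → ℝ) :
    GramSchmidt W B M 0 B s κ 0 where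
  symm := hB
  proj := by rw [hBM, Matrix.one_mul]
  ker := by simp
  trace := by simp [hBM]
  decomp := by simp
  zero := fun _ _ => rfl
  le_one := by simp
  diag := by simp
  tri := by simp
  pivot := by simp

/-- By `symm` and `proj`, `P = Pᵀ M P`. -/
theorem GramSchmidt.posSemidef (h : GramSchmidt W B M t P s κ U) (hM : M.PosSemidef) :
    P.PosSemidef := by
  have := hM.conjTranspose_mul_mul_same P
  rwa [conjTranspose_eq_transpose_of_trivial, h.symm, h.proj] at this

theorem PosSemidef.columnForm_self_nonneg (hB : B.PosSemidef) (i : Fin n) :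
    0 ≤ columnForm W B i i := by
  have := hB.dotProduct_mulVec_nonneg (W.col i)
  simpa [columnForm_apply] using this

theorem columnForm_comm (hB : Bᵀ = B) (i j : Fin n) : columnForm W B i j = columnForm W B j i := by
  rw [columnForm_apply, columnForm_apply, dotProduct_mulVec, ← mulVec_transpose, hB,
    dotProduct_comm]

/-- The form is nonnegative at `w_i ± w_j`, so twice the mixed value is bounded by the sum of the
two diagonal ones. -/
theorem abs_columnForm_le (hP : P.PosSemidef) {i j : Fin n}
    (hij : columnForm W P i i ≤ columnForm W P j j) :
    |columnForm W P j i| ≤ columnForm W P j j := by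
  have hs : Pᵀ = P := by
    rw [← conjTranspose_eq_transpose_of_trivial]; exact hP.1
  have hc := columnForm_comm (W := W) hs i j
  have h1 := hP.dotProduct_mulVec_nonneg (W.col i + W.col j)
  have h2 := hP.dotProduct_mulVec_nonneg (W.col i - W.col j)
  simp only [star_trivial, mulVec_add, mulVec_sub, add_dotProduct, sub_dotProduct, dotProduct_add,
    dotProduct_sub, ← columnForm_apply] at h1 h2
  rw [abs_le]
  constructor <;> linarith

/-- If the largest form vanished, so would the `M`-length of every `P w_i`. As `W` has a right
inverse, `P` would be `0`, against its trace condition. -/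
theorem GramSchmidt.pivot_pos (h : GramSchmidt W B M t P s κ U) (hM : M.PosDef) (ht : t < m)
    {Z : Matrix (Fin n) (Fin m) ℝ} (hZ : W * Z = 1) {j : Fin n}
    (hj : ∀ i, columnForm W P i i ≤ columnForm W P j j) : 0 < columnForm W P j j := by
  have hP := h.posSemidef hM.posSemidef
  refine lt_of_le_of_ne (hP.columnForm_self_nonneg j) fun h0 => ?_
  have hPW : ∀ i, P *ᵥ W.col i = 0 := by
    intro i
    by_contra hne
    have hpos := hM.dotProduct_mulVec_pos hne
    rw [star_trivial, mulVec_dotProduct h.symm, mulVec_mulVec, mulVec_mulVec,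
      h.proj, ← columnForm_apply] at hpos
    linarith [hj i]
  have hP0 : P = 0 := by
    have : P * W = 0 := by
      ext a i
      exact congrFun (hPW i) a
    rw [← Matrix.mul_one P, ← hZ, ← Matrix.mul_assoc, this, Matrix.zero_mul]
  have := h.trace
  rw [hP0, Matrix.zero_mul, trace_zero, eq_comm, sub_eq_zero] at this
  exact ht.ne (by exact_mod_cast this.symm)

/-- For `y = P x` and `δ = xᵀ P x`, `proj` gives `yᵀ M y = δ`; hence subtracting `y yᵀ / δ`
preserves `proj` and lowers the trace by one. Maximality of the pivot gives `le_one`, and it gives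
`pivot` because `δ` is at least the `p`-average of the forms, which is the trace `m - t`. -/
theorem GramSchmidt.step (h : GramSchmidt W B M t P s κ U) (hM : M.PosDef) (ht : t < m)
    {Z : Matrix (Fin n) (Fin m) ℝ} (hZ : W * Z = 1) {j : Fin n}
    (hj : ∀ i, columnForm W P i i ≤ columnForm W P j j) :
    GramSchmidt W B M (t + 1) (downdate P (W.col j) (1 / columnForm W P j j))
      (Function.update s ⟨t, ht⟩ j) (Function.update κ ⟨t, ht⟩ (columnForm W P j j))
      (Function.update U ⟨t, ht⟩ ((1 / columnForm W P j j) • (P *ᵥ W.col j))) := by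
  have hpos := h.pivot_pos hM ht hZ hj
  have hP := h.posSemidef hM.posSemidef
  have hδ := columnForm_apply W P j j
  have habs : ∀ i, |W.col j ⬝ᵥ (P *ᵥ W.col i)| ≤ columnForm W P j j :=
    fun i => abs_columnForm_le hP (hj i)
  generalize hx : W.col j = x at *
  generalize columnForm W P j j = δ at *
  have hne : δ ≠ 0 := hpos.ne'
  have hlt : ∀ l : Fin m, l ≠ ⟨t, ht⟩ → (l : ℕ) < t + 1 → (l : ℕ) < t := by
    intro l h1 h2
    have : (l : ℕ) ≠ t := fun h => h1 (Fin.ext h)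
    omega
  refine ⟨transpose_downdate h.symm _ _, ?_, ?_, ?_, ?_, ?_, ?_, ?_, ?_, ?_⟩
  · have h1 : P * M * vecMulVec (P *ᵥ x) (P *ᵥ x) = vecMulVec (P *ᵥ x) (P *ᵥ x) := by
      rw [mul_vecMulVec, mulVec_mulVec, h.proj]
    have h2 : vecMulVec (P *ᵥ x) (P *ᵥ x) * M * P = vecMulVec (P *ᵥ x) (P *ᵥ x) := by
      rw [vecMulVec_mul, vecMulVec_mul, vecMul_vecMul, ← vecMul_transpose, h.symm, vecMul_vecMul,
        ← Matrix.mul_assoc, h.proj]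
    have h3 : vecMulVec (P *ᵥ x) (P *ᵥ x) * M * vecMulVec (P *ᵥ x) (P *ᵥ x) =
        δ • vecMulVec (P *ᵥ x) (P *ᵥ x) := by
      rw [Matrix.mul_assoc, mul_vecMulVec, vecMulVec_mul_vecMulVec, mulVec_dotProduct h.symm,
        mulVec_mulVec, mulVec_mulVec, h.proj, ← hδ, vecMulVec_smul]
    rw [downdate, Matrix.sub_mul, Matrix.sub_mul, Matrix.mul_sub, Matrix.mul_sub, h.proj]
    simp only [Matrix.smul_mul, Matrix.mul_smul, h1, h2, h3, smul_smul]
    rw [one_div, inv_mul_cancel₀ hne, mul_one, sub_self, sub_zero]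
  · intro l hl
    rw [downdate_mulVec h.symm]
    by_cases hlt' : l = ⟨t, ht⟩
    · rw [hlt', Function.update_self, hx, ← hδ, one_div, inv_mul_cancel₀ hne, one_smul, sub_self]
    · rw [Function.update_of_ne hlt', h.ker l (hlt l hlt' hl)]
      simp
  · have h1 : vecMulVec (P *ᵥ x) (P *ᵥ x) * M = vecMulVec (P *ᵥ x) ((P *ᵥ x) ᵥ* M) :=
      vecMulVec_mul _ _ _
    rw [downdate, Matrix.sub_mul, Matrix.smul_mul, h1, trace_sub, trace_smul, trace_vecMulVec,
      h.trace]
    have : (P *ᵥ x) ⬝ᵥ ((P *ᵥ x) ᵥ* M) = δ := by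
      rw [dotProduct_comm, ← dotProduct_mulVec, mulVec_dotProduct h.symm, mulVec_mulVec,
        mulVec_mulVec, h.proj, hδ]
    rw [this, smul_eq_mul, one_div, inv_mul_cancel₀ hne]
    push_cast
    ring
  · have h1 : ∀ l, Function.update κ ⟨t, ht⟩ δ l •
        vecMulVec (Function.update U ⟨t, ht⟩ ((1 / δ) • (P *ᵥ x)) l)
          (Function.update U ⟨t, ht⟩ ((1 / δ) • (P *ᵥ x)) l) =
        κ l • vecMulVec (U l) (U l) +
          if l = ⟨t, ht⟩ then (1 / δ) • vecMulVec (P *ᵥ x) (P *ᵥ x) else 0 := by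
      intro l
      by_cases hl : l = ⟨t, ht⟩
      · subst hl
        rw [if_pos rfl, Function.update_self, Function.update_self, h.zero _ le_rfl]
        simp only [smul_vecMulVec, vecMulVec_smul, smul_smul, zero_vecMulVec, smul_zero, zero_add]
        congr 1
        field_simp
      · rw [if_neg hl, Function.update_of_ne hl, Function.update_of_ne hl, add_zero]
    simp only [h1, sum_add_distrib, sum_ite_eq', mem_univ, if_true, downdate]
    rw [← h.decomp]
    abel
  · intro l hl
    rw [Function.update_of_ne, h.zero l (by omega)]
    intro h
    rw [h] at hl
    simp at hl
  · intro l i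
    by_cases hl : l = ⟨t, ht⟩
    · rw [hl, Function.update_self, smul_dotProduct, mulVec_dotProduct h.symm, smul_eq_mul, abs_mul,
        abs_of_pos (one_div_pos.2 hpos), one_div, inv_mul_le_iff₀ hpos, mul_one]
      exact habs i
    · rw [Function.update_of_ne hl]
      exact h.le_one l i
  · intro l hl
    by_cases hlt' : l = ⟨t, ht⟩
    · rw [hlt', Function.update_self, Function.update_self, hx, smul_dotProduct,
        mulVec_dotProduct h.symm, ← hδ, smul_eq_mul, one_div, inv_mul_cancel₀ hne]
    · rw [Function.update_of_ne hlt', Function.update_of_ne hlt']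
      exact h.diag l (hlt l hlt' hl)
  · intro l l' hl hl'
    have hne' : l' ≠ ⟨t, ht⟩ := by
      intro h
      rw [h, Fin.lt_def] at hl'
      simp only at hl'
      omega
    rw [Function.update_of_ne hne']
    by_cases hlt' : l = ⟨t, ht⟩
    · rw [hlt', Fin.lt_def] at hl'
      rw [hlt', Function.update_self, smul_dotProduct, mulVec_dotProduct h.symm, h.ker l' hl']
      simp
    · rw [Function.update_of_ne hlt']
      exact h.tri l l' (hlt l hlt' hl) hl'
  · intro l hl p hp hpM
    by_cases hlt' : l = ⟨t, ht⟩
    · rw [hlt', Function.update_self, ← h.trace, ← hpM, trace_mul_moment]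
      calc ∑ i, p i * columnForm W P i i ≤ ∑ i, p i * δ :=
            sum_le_sum fun i _ => mul_le_mul_of_nonneg_left (hj i) (hp.1 i)
        _ = δ := by rw [← sum_mul, hp.2, one_mul]
    · rw [Function.update_of_ne hlt']
      exact h.pivot l (hlt l hlt' hl) p hp hpM

/-- The functionals applied to the chosen columns form a unitriangular matrix. -/
theorem GramSchmidt.det_eq_one (h : GramSchmidt W B M m P s κ U) :
    (of U).det * (W.submatrix id s).det = 1 := by
  rw [← det_mul, det_of_isUpperTriangular]
  · exact prod_eq_one fun l _ => h.diag l l.2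
  · exact fun l l' hl => h.tri l l' l.2 hl

/-- After `m` steps `P` annihilates a basis, so `decomp` becomes `B = Uᵀ diag(κ) U`. -/
theorem GramSchmidt.sq_det (h : GramSchmidt W B M m P s κ U) (hBM : B * M = 1) :
    (W.submatrix id s).det ^ 2 = (∏ l, κ l) * M.det := by
  have h1 := h.det_eq_one
  have hu : IsUnit (W.submatrix id s).det := IsUnit.of_mul_eq_one_right _ h1
  have hP : P = 0 := by
    have h0 : P * W.submatrix id s = 0 := by
      ext a l
      exact congrFun (h.ker l l.2) a
    rw [← Matrix.mul_one P, ← mul_nonsing_inv _ hu, ← Matrix.mul_assoc, h0, Matrix.zero_mul]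
  have hB : B = (of U)ᵀ * diagonal κ * of U := by
    rw [← h.decomp, hP, zero_add]
    ext a b
    simp only [mul_apply, sum_apply, smul_apply, vecMulVec_apply, diagonal_apply, mul_ite, mul_zero,
      sum_ite_eq', mem_univ, if_true, transpose_apply, of_apply, smul_eq_mul]
    exact sum_congr rfl fun l _ => by ring
  have h2 : B.det * M.det = 1 := by rw [← det_mul, hBM, det_one]
  rw [hB, det_mul, det_mul, det_transpose, det_diagonal] at h2
  linear_combination -(W.submatrix id s).det ^ 2 * h2 + (∏ l, κ l) * M.det *
    ((of U).det * (W.submatrix id s).det + 1) * h1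

theorem GramSchmidt.factorial_mul_det_le (h : GramSchmidt W B M m P s κ U) (hBM : B * M = 1)
    {p : Fin n → ℝ} (hp : IsWeight p) (hM : moment W p = M) :
    (m.factorial : ℝ) * M.det ≤ (W.submatrix id s).det ^ 2 := by
  rw [h.sq_det hBM]
  have hM0 : 0 ≤ M.det := hM ▸ (moment_posSemidef W hp.1).det_nonneg
  refine mul_le_mul_of_nonneg_right ?_ hM0
  have : (m.factorial : ℝ) = ∏ l : Fin m, ((m : ℝ) - l) := by
    rw [← Finset.prod_range fun l => (m : ℝ) - l, ← Nat.descFactorial_self,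
      Nat.descFactorial_eq_prod_range, Nat.cast_prod]
    exact prod_congr rfl fun l hl => by rw [Nat.cast_sub (mem_range.1 hl).le]
  rw [this]
  refine prod_le_prod (fun l _ => ?_) fun l _ => h.pivot l l.2 p hp hM
  have : (l : ℝ) < m := by exact_mod_cast l.2
  linarith

/-- The entries of `U W` are at most `1` in absolute value, so its moment matrix has trace at most
`m` and determinant at most `1`. -/
theorem GramSchmidt.det_moment_le (h : GramSchmidt W B M m P s κ U) (hm : 0 < m)
    {p : Fin n → ℝ} (hp : IsWeight p) : (moment W p).det ≤ (W.submatrix id s).det ^ 2 := by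
  have h1 := h.det_eq_one
  have h2 : (moment (of U * W) p).det ≤ 1 := by
    refine ((moment_posSemidef _ hp.1).det_le_trace_pow hm).trans ?_
    have h0 := (moment_posSemidef (of U * W) hp.1).trace_nonneg
    refine pow_le_one₀ (by positivity) ((div_le_one (by positivity)).2 ?_)
    have := trace_mul_moment 1 (of U * W) p
    rw [Matrix.one_mul] at this
    rw [this]
    calc _ ≤ ∑ i, p i * m := by
          refine sum_le_sum fun i _ => mul_le_mul_of_nonneg_left ?_ (hp.1 i)
          rw [columnForm_apply, one_mulVec, dotProduct]
          calc _ ≤ ∑ l : Fin m, (1 : ℝ) := sum_le_sum fun l _ => by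
                have := h.le_one l i
                rw [← sq, sq_le_one_iff_abs_le_one]
                exact this
            _ = m := by simp
      _ = m := by rw [← sum_mul, hp.2, one_mul]
  rw [det_moment_mul] at h2
  have h3 := mul_le_mul_of_nonneg_right h2 (sq_nonneg (W.submatrix id s).det)
  rw [one_mul] at h3
  refine le_trans (le_of_eq ?_) h3
  linear_combination -(moment W p).det * ((of U).det * (W.submatrix id s).det + 1) * h1

end GramSchmidt

end Matrix

/-! ### Binomial estimates and the potential function. -/

section Numeric
open Finset

/-- Factor by factor, `(2m-1)(m-i) ≤ m(2m-1-i)`. -/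
theorem pow_le_choose_mul_pow {m k : ℕ} (hk : k ≤ 2 * m - 1) :
    k ^ m ≤ (2 * m - 1).choose m * m ^ m := by
  have h1 : (2 * m - 1) ^ m * m.descFactorial m ≤ m ^ m * (2 * m - 1).descFactorial m := by
    rw [Nat.descFactorial_eq_prod_range, Nat.descFactorial_eq_prod_range]
    have hc : ∀ a : ℕ, a ^ m = ∏ _i ∈ range m, a := by simp
    rw [hc, hc, ← prod_mul_distrib, ← prod_mul_distrib]
    refine prod_le_prod (fun _ _ => Nat.zero_le _) fun i hi => ?_
    have hi := mem_range.1 hi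
    obtain ⟨a, rfl⟩ : ∃ a, m = i + 1 + a := ⟨m - (i + 1), by omega⟩
    have e1 : 2 * (i + 1 + a) - 1 = 2 * i + 2 * a + 1 := by omega
    have e2 : i + 1 + a - i = a + 1 := by omega
    have e3 : 2 * i + 2 * a + 1 - i = i + 2 * a + 1 := by omega
    rw [e1, e2, e3]
    nlinarith [Nat.zero_le (i * i), Nat.zero_le (i * a)]
  rw [Nat.descFactorial_self, Nat.descFactorial_eq_factorial_mul_choose] at h1
  have h2 : k ^ m ≤ (2 * m - 1) ^ m := Nat.pow_le_pow_left hk m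
  refine h2.trans (Nat.le_of_mul_le_mul_right (h1.trans_eq ?_) (Nat.factorial_pos m))
  ring

/-- The binomial coefficient times `m!` is `∏ (m + i)`. Pairing `i` with `m - 1 - i` bounds its
square below by `(m(2m-1))^m`, so it remains to compare `k²` with `4^(j/m) m(2m-1)`, where `k = m +
j`. -/
theorem pow_le_choose_mul_two_pow {m k : ℕ} (hm : 1 ≤ m) (hmk : m ≤ k) (hk : k ≤ 2 * m - 1) :
    (k : ℝ) ^ m ≤ (2 * m - 1).choose m * (2 ^ (k - m) * m.factorial) := by
  obtain ⟨j, rfl⟩ := Nat.exists_eq_add_of_le hmk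
  rw [Nat.add_sub_cancel_left]
  have hfac : ((2 * m - 1).choose m : ℝ) * (2 ^ j * m.factorial) =
      2 ^ j * ∏ i ∈ range m, ((m : ℝ) + i) := by
    have := Nat.ascFactorial_eq_factorial_mul_choose' m m
    rw [Nat.ascFactorial_eq_prod_range, ← two_mul] at this
    have h' : (∏ i ∈ range m, ((m : ℝ) + i)) = m.factorial * (2 * m - 1).choose m := by
      exact_mod_cast this
    rw [h']
    ring
  have hm0 : (0 : ℝ) < m := by exact_mod_cast hm
  have hprod : ((m : ℝ) * (2 * m - 1)) ^ m ≤ (∏ i ∈ range m, ((m : ℝ) + i)) ^ 2 := by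
    have hr : ∏ i ∈ range m, ((m : ℝ) + i) = ∏ i ∈ range m, (2 * (m : ℝ) - 1 - i) := by
      rw [← prod_range_reflect]
      refine prod_congr rfl fun i hi => ?_
      have hi := mem_range.1 hi
      rw [Nat.cast_sub (by omega), Nat.cast_sub (by omega)]
      push_cast
      ring
    rw [sq]
    nth_rewrite 2 [hr]
    rw [← prod_mul_distrib]
    have hc : ∀ a : ℝ, a ^ m = ∏ _i ∈ range m, a := by simp
    rw [hc]
    refine prod_le_prod (fun _ _ => ?_) fun i hi => ?_
    · have : (1 : ℝ) ≤ m := by exact_mod_cast hm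
      exact mul_nonneg hm0.le (by linarith)
    · have hi : (i : ℝ) + 1 ≤ m := by exact_mod_cast mem_range.1 hi
      nlinarith [mul_nonneg (Nat.cast_nonneg (α := ℝ) i) (sub_nonneg.2 hi)]
  have hbase : (((m + j : ℕ) : ℝ) ^ m) ^ 2 ≤ (2 ^ j) ^ 2 * ((m : ℝ) * (2 * m - 1)) ^ m := by
    rcases Nat.eq_or_lt_of_le hm with rfl | hm2
    · obtain rfl : j = 0 := by omega
      norm_num
    have hm2' : (2 : ℝ) ≤ m := by exact_mod_cast hm2
    set x : ℝ := j / m with hx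
    have hxm : x * m = j := by rw [hx]; field_simp
    have hx0 : 0 ≤ x := by positivity
    have hx1 : x ≤ 1 := by
      rw [hx, div_le_one hm0]
      exact_mod_cast (by omega : j ≤ m)
    have h2x : 1 + 0.69 * x ≤ (2 : ℝ) ^ x := by
      rw [Real.rpow_def_of_pos two_pos]
      have := Real.add_one_le_exp (Real.log 2 * x)
      nlinarith [Real.log_two_gt_d9]
    have hp : ((2 : ℝ) ^ x) ^ m = 2 ^ j := by
      rw [← Real.rpow_natCast, ← Real.rpow_mul two_pos.le, hxm, Real.rpow_natCast]
    have h0 : (0 : ℝ) < 2 ^ x := by positivity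
    -- The factor `1.2` works since `x ≤ 1`, and its square `1.44` fits into `m(2m-1)` for `m ≥ 2`;
    -- this is why `m = 1` was split off.
    have hk1 : 1 + x ≤ 1.2 * (2 : ℝ) ^ x := by linarith
    have hk2 : (((m + j : ℕ) : ℝ)) ^ 2 ≤ ((2 : ℝ) ^ x) ^ 2 * (m * (2 * m - 1)) := by
      have : (((m + j : ℕ) : ℝ)) = m * (1 + x) := by push_cast; linarith
      rw [this]
      have hsq : (1 + x) ^ 2 ≤ (1.2 * (2 : ℝ) ^ x) ^ 2 := pow_le_pow_left₀ (by linarith) hk1 2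
      have hm3 : 1.44 * (m : ℝ) ^ 2 ≤ m * (2 * m - 1) := by nlinarith
      calc ((m : ℝ) * (1 + x)) ^ 2 = (m : ℝ) ^ 2 * (1 + x) ^ 2 := by ring
        _ ≤ (m : ℝ) ^ 2 * (1.2 * (2 : ℝ) ^ x) ^ 2 := by gcongr
        _ = ((2 : ℝ) ^ x) ^ 2 * (1.44 * (m : ℝ) ^ 2) := by ring
        _ ≤ _ := by gcongr
    have := pow_le_pow_left₀ (by positivity) hk2 m
    rw [mul_pow, ← pow_mul, ← pow_mul, mul_comm 2 m, pow_mul, pow_mul, hp] at this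
    exact this
  rw [hfac]
  refine (pow_le_pow_iff_left₀ (by positivity) (by positivity) two_ne_zero).1 ?_
  rw [mul_pow]
  exact hbase.trans (by gcongr)

/-- One bound for both regimes of the decrease: quadratic for small `h`, linear for large `h`. -/
theorem sq_div_le_exp_neg {h : ℝ} (h0 : 0 ≤ h) :
    h ^ 2 / (2 * (2 + h)) ≤ h - 1 + Real.exp (-h) := by
  rw [div_le_iff₀ (by positivity)]
  rcases le_total h 2 with h2 | h2
  · have h1 : 1 - h / 2 ≤ Real.exp (-h / 2) := by
      have := Real.add_one_le_exp (-h / 2)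
      linarith
    have h3 : Real.exp (-h) = Real.exp (-h / 2) ^ 2 := by
      rw [← Real.exp_nat_mul]; congr 1; push_cast; ring
    have h4 : (1 - h / 2) ^ 2 ≤ Real.exp (-h) := by
      rw [h3]
      exact pow_le_pow_left₀ (by linarith) h1 2
    nlinarith
  · nlinarith [Real.exp_pos (-h)]

/-- A potential for sequences that decrease at the rate of the Frank–Wolfe algorithm. -/
noncomputable def potential (η u : ℝ) : ℝ := 4 * Real.log (u + η) - 16 / (u + η)

theorem potential_mono {η u v : ℝ} (hη : 0 < η) (hu : 0 ≤ u) (huv : u ≤ v) :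
    potential η u ≤ potential η v := by
  have := Real.log_le_log (by linarith : 0 < u + η) (by linarith : u + η ≤ v + η)
  have : 16 / (v + η) ≤ 16 / (u + η) := by gcongr
  unfold potential
  linarith

/-- The potential is concave with derivative `4/(u+η) + 16/(u+η)²`. This dominates `2(2+h)/h²`, the
reciprocal rate of decrease, because `h ≥ (u+η)/2`. -/
theorem potential_step {η u u' h r : ℝ} (hη : 0 < η) (hr : 0 ≤ r) (hu' : 0 ≤ u') (huh : u ≤ h)
    (hηh : η ≤ h) (hstep : u' ≤ u - r * (h - 1 + Real.exp (-h))) :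
    potential η u' + r ≤ potential η u := by
  have hh : 0 < h := by linarith
  have hg := sq_div_le_exp_neg hh.le
  have hg0 : 0 ≤ h - 1 + Real.exp (-h) := le_trans (by positivity) hg
  have hle : u' ≤ u := by nlinarith
  have ha : 0 < u + η := by linarith
  have ha' : 0 < u' + η := by linarith
  have h1 : Real.log (u' + η) + (u - u') / (u + η) ≤ Real.log (u + η) := by
    have := Real.log_le_sub_one_of_pos (div_pos ha' ha)
    rw [Real.log_div ha'.ne' ha.ne'] at this
    have e : (u' + η) / (u + η) - 1 = -((u - u') / (u + η)) := by field_simp; ring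
    linarith
  have h2 : 16 / (u + η) + 16 * (u - u') / (u + η) ^ 2 ≤ 16 / (u' + η) := by
    rw [div_add_div _ _ ha.ne' (by positivity), div_le_div_iff₀ (by positivity) ha']
    have : 0 ≤ (u + η) * (u - u') ^ 2 := by positivity
    nlinarith
  have h3 : r * (h ^ 2 / (2 * (2 + h))) ≤ u - u' := by nlinarith
  have h4 : r ≤ 4 * ((u - u') / (u + η)) + 16 * (u - u') / (u + η) ^ 2 := by
    have e : 4 * ((u - u') / (u + η)) + 16 * (u - u') / (u + η) ^ 2 =
        (u - u') * (4 * ((u + η) + 4) / (u + η) ^ 2) := by field_simp; ring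
    have h5 : 2 * (2 + h) / h ^ 2 ≤ 4 * ((u + η) + 4) / (u + η) ^ 2 := by
      rw [div_le_div_iff₀ (by positivity) (by positivity)]
      have : u + η ≤ 2 * h := by linarith
      nlinarith [mul_pos ha hh, mul_nonneg (sub_nonneg.2 this) ha.le,
        mul_nonneg (sub_nonneg.2 this) hh.le, mul_nonneg (mul_nonneg (sub_nonneg.2 this) ha.le) hh.le]
    calc r = r * (h ^ 2 / (2 * (2 + h))) * (2 * (2 + h) / h ^ 2) := by field_simp
      _ ≤ (u - u') * (2 * (2 + h) / h ^ 2) := by gcongr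
      _ ≤ (u - u') * (4 * ((u + η) + 4) / (u + η) ^ 2) := by
          have : 0 ≤ u - u' := by linarith
          gcongr
      _ = _ := e.symm
  unfold potential
  linarith

theorem potential_sub_le {m : ℕ} {η u : ℝ} (hη : 0 < η) (hu : 0 ≤ u)
    (hum : u ≤ Real.log m) : potential η u - potential η 0 ≤
      8 * max 1 (Real.log (Real.log m)) + 20 / η := by
  have hL0 : 0 ≤ Real.log m := hu.trans hum
  have h1 : Real.log (1 + Real.log m) ≤ 2 * max 1 (Real.log (Real.log m)) := by
    rcases le_total 1 (Real.log m) with h | h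
    · have h2 : Real.log (1 + Real.log m) ≤ Real.log (2 * Real.log m) :=
        Real.log_le_log (by linarith) (by linarith)
      rw [Real.log_mul two_ne_zero (by linarith)] at h2
      have := Real.log_two_lt_d9
      linarith [le_max_left 1 (Real.log (Real.log m)), le_max_right 1 (Real.log (Real.log m))]
    · have h2 : Real.log (1 + Real.log m) ≤ Real.log 2 :=
        Real.log_le_log (by linarith) (by linarith)
      have := Real.log_two_lt_d9
      linarith [le_max_left 1 (Real.log (Real.log m))]
  have h2 : Real.log (u + η) ≤ Real.log (1 + Real.log m) + 1 / η + Real.log η := by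
    -- The product separates the two contributions: `log (1 + log m)` and `log (1 + 1/η) ≤ 1/η`.
    have h3 : Real.log (u + η) ≤ Real.log ((1 + Real.log m) * (1 + 1 / η) * η) := by
      refine Real.log_le_log (by linarith) ?_
      have : (1 + Real.log m) * (1 + 1 / η) * η = (1 + Real.log m) * (η + 1) := by field_simp
      rw [this]
      nlinarith
    have h4 : 0 < 1 + 1 / η := by positivity
    have h5 := Real.log_le_sub_one_of_pos h4
    rw [Real.log_mul (by positivity) hη.ne', Real.log_mul (by positivity) h4.ne'] at h3
    linarith
  have h3 : 0 ≤ 16 / (u + η) := by positivity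
  have e : 20 / η = 4 * (1 / η) + 16 / η := by ring
  unfold potential
  rw [zero_add, e]
  linarith

end Numeric

/-! ### Optimal designs, Frank–Wolfe steps and greedy rounding. -/

namespace Matrix
open Finset

variable {m n : ℕ} {W : Matrix (Fin m) (Fin n) ℝ} {B : Matrix (Fin m) (Fin m) ℝ}

theorem det_pos_of_mul_moment {q : Fin n → ℝ} (hq : 0 ≤ q) (h : B * moment W q = 1) :
    0 < (moment W q).det := by
  refine lt_of_le_of_ne (moment_posSemidef W hq).det_nonneg fun h0 => ?_
  have := congrArg det h
  rw [det_mul, ← h0, mul_zero, det_one] at this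
  exact zero_ne_one this

theorem posDef_moment {q : Fin n → ℝ} (hq : 0 ≤ q) (h : B * moment W q = 1) :
    (moment W q).PosDef :=
  (moment_posSemidef W hq).posDef_iff_det_ne_zero.2 (det_pos_of_mul_moment hq h).ne'

theorem posSemidef_of_mul_moment {q : Fin n → ℝ} (hq : 0 ≤ q) (h : B * moment W q = 1) :
    B.PosSemidef := by
  rw [← inv_eq_left_inv h]
  exact (moment_posSemidef W hq).inv

theorem transpose_of_mul_moment {q : Fin n → ℝ} (hq : 0 ≤ q) (h : B * moment W q = 1) :
    Bᵀ = B := by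
  rw [← conjTranspose_eq_transpose_of_trivial]
  exact (posSemidef_of_mul_moment hq h).1

/-- The supremum of the determinants of the moment matrices of probability weights. -/
noncomputable def optimalDet (W : Matrix (Fin m) (Fin n) ℝ) : ℝ :=
  sSup {x | ∃ p, IsWeight p ∧ (moment W p).det = x}

/-- The normalized logarithmic distance of `p` from the optimal design. -/
noncomputable def gap (W : Matrix (Fin m) (Fin n) ℝ) (p : Fin n → ℝ) : ℝ :=
  (Real.log (optimalDet W) - Real.log (moment W p).det) / m

theorem det_moment_le_optimalDet {D : ℝ} (hD : ∀ p, IsWeight p → (moment W p).det ≤ D)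
    {p : Fin n → ℝ} (hp : IsWeight p) : (moment W p).det ≤ optimalDet W :=
  le_csSup ⟨D, by rintro x ⟨q, hq, rfl⟩; exact hD q hq⟩ ⟨p, hp, rfl⟩

theorem gap_nonneg {D : ℝ} (hD : ∀ p, IsWeight p → (moment W p).det ≤ D)
    {p : Fin n → ℝ} (hp : IsWeight p) (h : B * moment W p = 1) : 0 ≤ gap W p := by
  have := Real.log_le_log (det_pos_of_mul_moment hp.1 h) (det_moment_le_optimalDet hD hp)
  exact div_nonneg (sub_nonneg.2 this) (Nat.cast_nonneg m)

/-- Weak duality against every competing weight `q`: the `q`-average of the forms is at most `κ`. -/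
theorem gap_le_log {D : ℝ} (hD : ∀ p, IsWeight p → (moment W p).det ≤ D) (hm : 0 < m)
    {p : Fin n → ℝ} (hp : IsWeight p) (h : B * moment W p = 1) {κ : ℝ} (hκ : 0 < κ)
    (hmax : ∀ i, columnForm W B i i ≤ κ) : gap W p ≤ Real.log (κ / m) := by
  have hm0 : (0 : ℝ) < m := by exact_mod_cast hm
  have hpos := det_pos_of_mul_moment hp.1 h
  have h1 : optimalDet W ≤ (κ / m) ^ m * (moment W p).det := by
    refine csSup_le ⟨_, p, hp, rfl⟩ ?_
    rintro _ ⟨q, hq, rfl⟩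
    have hB := posSemidef_of_mul_moment hp.1 h
    refine (det_moment_le hB h hq.1 hm).trans ?_
    have h0 : 0 ≤ ∑ i, q i * columnForm W B i i :=
      sum_nonneg fun i _ => mul_nonneg (hq.1 i) (hB.columnForm_self_nonneg i)
    have : ∑ i, q i * columnForm W B i i ≤ κ := by
      calc _ ≤ ∑ i, q i * κ := sum_le_sum fun i _ => mul_le_mul_of_nonneg_left (hmax i) (hq.1 i)
        _ = κ := by rw [← sum_mul, hq.2, one_mul]
    gcongr
  have hopt : 0 < optimalDet W := hpos.trans_le (det_moment_le_optimalDet hD hp)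
  have h2 := Real.log_le_log hopt h1
  rw [Real.log_mul (by positivity) hpos.ne', Real.log_pow] at h2
  rw [gap, div_le_iff₀ hm0]
  linarith

/-- The weights after a Frank–Wolfe step towards the column `j`. -/
noncomputable def shiftWeight (p : Fin n → ℝ) (j : Fin n) (s : ℝ) : Fin n → ℝ :=
  (1 + s)⁻¹ • (p + s • Pi.single j 1)

theorem IsWeight.shiftWeight {p : Fin n → ℝ} (hp : IsWeight p) (j : Fin n) {s : ℝ} (hs : 0 ≤ s) :
    IsWeight (shiftWeight p j s) := by
  refine ⟨fun i => ?_, ?_⟩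
  · have h1 := hp.1 i
    have h2 : (0 : ℝ) ≤ (Pi.single j 1 : Fin n → ℝ) i := by
      rw [Pi.single_apply]; split_ifs <;> norm_num
    simp only [Pi.zero_apply, Matrix.shiftWeight, Pi.smul_apply, Pi.add_apply, smul_eq_mul] at *
    positivity
  · simp only [Matrix.shiftWeight, Pi.smul_apply, Pi.add_apply, smul_eq_mul, ← mul_sum,
      sum_add_distrib, hp.2, sum_pi_single', mem_univ, if_true, mul_one]
    exact inv_mul_cancel₀ (by positivity)

theorem moment_shiftWeight (p : Fin n → ℝ) (j : Fin n) (s : ℝ) :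
    moment W (shiftWeight p j s) =
      (1 + s)⁻¹ • (moment W p + s • vecMulVec (W.col j) (W.col j)) := by
  rw [shiftWeight, moment_smul, moment_add, moment_smul, moment_single]

theorem mul_moment_shiftWeight {p : Fin n → ℝ} (hp : IsWeight p) (h : B * moment W p = 1)
    (j : Fin n) {s : ℝ} (hs : 0 ≤ s) :
    ((1 + s) • downdate B (W.col j) (s / (1 + s * columnForm W B j j))) *
      moment W (shiftWeight p j s) = 1 := by
  have h0 := (posSemidef_of_mul_moment hp.1 h).columnForm_self_nonneg (W := W) j
  rw [moment_shiftWeight, Matrix.smul_mul, Matrix.mul_smul, smul_smul, mul_inv_cancel₀ (by positivity),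
    one_smul]
  exact downdate_mul_add (transpose_of_mul_moment hp.1 h) h (W.col j)
    (by rw [← columnForm_apply]; positivity)

/-- The step size `s = 1/m - 1/κ` makes the rank one factor `1 + sκ` equal to `κ/m`. Normalization
costs `m log (1 + s) ≤ ms = 1 - m/κ`, which is `1 - exp (-h)` for `h = log (κ/m)`. -/
theorem gap_shiftWeight_le (hm : 0 < m) {p : Fin n → ℝ} (hp : IsWeight p)
    (h : B * moment W p = 1) {j : Fin n} (hj : m < columnForm W B j j) :
    gap W (shiftWeight p j (1 / m - 1 / columnForm W B j j)) ≤ gap W p - 1 / m *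
      (Real.log (columnForm W B j j / m) - 1 + Real.exp (-Real.log (columnForm W B j j / m))) := by
  have hm0 : (0 : ℝ) < m := by exact_mod_cast hm
  have hpos := det_pos_of_mul_moment hp.1 h
  have hdet := det_add_smul_vecMulVec h (W.col j) (1 / m - 1 / columnForm W B j j)
  rw [← columnForm_apply] at hdet
  generalize columnForm W B j j = κ at *
  have hκ : 0 < κ := hm0.trans hj
  have hs : 0 < 1 / (m : ℝ) - 1 / κ := sub_pos.2 (one_div_lt_one_div_of_lt hm0 hj)
  have e1 : 1 + (1 / (m : ℝ) - 1 / κ) * κ = κ / m := by field_simp; ring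
  rw [e1] at hdet
  have h1 : Real.log (moment W (shiftWeight p j (1 / m - 1 / κ))).det =
      Real.log (moment W p).det + Real.log (κ / m) - m * Real.log (1 + (1 / m - 1 / κ)) := by
    rw [moment_shiftWeight, det_smul, Fintype.card_fin, hdet, Real.log_mul (by positivity)
      (by positivity), Real.log_mul (by positivity) (by positivity), Real.log_pow, Real.log_inv]
    ring
  have h2 := Real.log_le_sub_one_of_pos (show 0 < 1 + (1 / (m : ℝ) - 1 / κ) by positivity)
  have h3 : m * Real.log (1 + (1 / m - 1 / κ)) ≤ 1 - m / κ := by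
    calc _ ≤ m * (1 + (1 / (m : ℝ) - 1 / κ) - 1) := by gcongr
      _ = _ := by field_simp; ring
  rw [← Real.log_inv, Real.exp_log (by positivity), inv_div, gap, gap, h1]
  have e2 : (Real.log (optimalDet W) - Real.log (moment W p).det) / m -
      1 / m * (Real.log (κ / m) - 1 + m / κ) =
      (Real.log (optimalDet W) - Real.log (moment W p).det - (Real.log (κ / m) - 1 + m / κ)) / m := by
    ring
  rw [e2]
  exact div_le_div_of_nonneg_right (by linarith) hm0.le

/-- The indicator function of a set of columns. -/
def indicatorWeight (S : Finset (Fin n)) : Fin n → ℝ := fun i => if i ∈ S then 1 else 0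

theorem indicatorWeight_nonneg (S : Finset (Fin n)) : 0 ≤ indicatorWeight S := fun i => by
  simp only [indicatorWeight, Pi.zero_apply]; split_ifs <;> norm_num

theorem colVolume_eq (X : Matrix (Fin m) (Fin n) ℝ) (S : Finset (Fin n)) :
    colVolume X S = Real.sqrt (moment X (indicatorWeight S)).det := by
  rw [colVolume]
  congr 2
  ext a b
  simp only [mul_apply, moment, transpose_apply, submatrix_apply, id, diagonal_apply,
    indicatorWeight, mul_ite, mul_one, mul_zero, sum_ite_eq', mem_univ, if_true, ite_mul, zero_mul]
  rw [← sum_filter]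
  simp only [filter_mem_eq_inter, univ_inter]
  exact sum_coe_sort S fun i => X a i * X b i

theorem det_moment_indicatorWeight_le (hm : 0 < m) {p : Fin n → ℝ} (hp : 0 ≤ p)
    (h : B * moment W p = 1) {r : ℝ} (hr : ∀ i, columnForm W B i i ≤ r * m) (T : Finset (Fin n)) :
    (moment W (indicatorWeight T)).det ≤ (T.card * r) ^ m * (moment W p).det := by
  have hm0 : (0 : ℝ) < m := by exact_mod_cast hm
  have hB := posSemidef_of_mul_moment hp h
  have hpos := det_pos_of_mul_moment hp h
  refine (det_moment_le hB h (indicatorWeight_nonneg T) hm).trans ?_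
  have h0 : 0 ≤ ∑ i, indicatorWeight T i * columnForm W B i i :=
    sum_nonneg fun i _ => mul_nonneg (indicatorWeight_nonneg T i) (hB.columnForm_self_nonneg i)
  have : (∑ i, indicatorWeight T i * columnForm W B i i) / m ≤ T.card * r := by
    rw [div_le_iff₀ hm0]
    simp only [indicatorWeight, ite_mul, one_mul, zero_mul, ← sum_filter, filter_mem_eq_inter,
      univ_inter]
    calc _ ≤ ∑ i ∈ T, r * (m : ℝ) := sum_le_sum fun i _ => hr i
      _ = _ := by rw [sum_const, nsmul_eq_mul]; ring
  gcongr

theorem moment_indicatorWeight_insert {S : Finset (Fin n)} {j : Fin n} (hj : j ∉ S) :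
    moment W (indicatorWeight (insert j S)) =
      moment W (indicatorWeight S) + (1 : ℝ) • vecMulVec (W.col j) (W.col j) := by
  rw [← moment_single, one_smul, ← moment_add]
  congr 1
  funext i
  simp only [indicatorWeight, mem_insert, Pi.add_apply, Pi.single_apply]
  by_cases h : i = j
  · simp [h, hj]
  · simp [h]

/-- Leverage scores are at most `1`: evaluating the moment matrix without column `i` at `B w_i`
gives `κ - κ² ≥ 0`. -/
theorem columnForm_le_one {S : Finset (Fin n)} (h : B * moment W (indicatorWeight S) = 1)
    {i : Fin n} (hi : i ∈ S) : columnForm W B i i ≤ 1 := by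
  have h0 := indicatorWeight_nonneg S
  have hB := posSemidef_of_mul_moment h0 h
  have hBt := transpose_of_mul_moment h0 h
  have h1 := moment_indicatorWeight_insert (W := W) (notMem_erase i S)
  rw [insert_erase hi, one_smul] at h1
  have h2 := (moment_posSemidef W (indicatorWeight_nonneg (S.erase i))).dotProduct_mulVec_nonneg
    (B *ᵥ W.col i)
  have h3 : B * moment W (indicatorWeight S) * B = B := by rw [h, Matrix.one_mul]
  rw [star_trivial, eq_sub_of_add_eq h1.symm, sub_mulVec, dotProduct_sub, mulVec_dotProduct hBt,
    mulVec_mulVec, mulVec_mulVec, h3, ← columnForm_apply, vecMulVec_mulVec, op_smul_eq_smul,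
    dotProduct_smul, ← columnForm_apply, dotProduct_comm, ← columnForm_apply, smul_eq_mul] at h2
  by_contra hc
  nlinarith

/-- Otherwise the `p`-average of the forms is at most `1`, and weak duality bounds `det (moment W
p)` by `m^(-m)` times the determinant of `S`. -/
theorem exists_one_lt_columnForm (hm : 0 < m) {S : Finset (Fin n)}
    (h : B * moment W (indicatorWeight S) = 1) {p : Fin n → ℝ} (hp : IsWeight p)
    (hlt : (moment W (indicatorWeight S)).det < (m : ℝ) ^ m * (moment W p).det) :
    ∃ i ∉ S, 1 < columnForm W B i i := by
  by_contra! hc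
  have hm0 : (0 : ℝ) < m := by exact_mod_cast hm
  have hB := posSemidef_of_mul_moment (indicatorWeight_nonneg S) h
  have h1 : ∑ i, p i * columnForm W B i i ≤ 1 := by
    rw [← hp.2]
    refine sum_le_sum fun i _ => mul_le_of_le_one_right (hp.1 i) ?_
    by_cases hi : i ∈ S
    · exact columnForm_le_one h hi
    · exact hc i hi
  have h0 : 0 ≤ ∑ i, p i * columnForm W B i i :=
    sum_nonneg fun i _ => mul_nonneg (hp.1 i) (hB.columnForm_self_nonneg i)
  have h2 := det_moment_le (W := W) hB h hp.1 hm
  have hpos := det_pos_of_mul_moment (indicatorWeight_nonneg S) h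
  have h3 : (moment W p).det ≤ (1 / m) ^ m * (moment W (indicatorWeight S)).det :=
    h2.trans (by gcongr)
  have h4 : (m : ℝ) ^ m * (moment W p).det ≤ (moment W (indicatorWeight S)).det := by
    calc _ ≤ (m : ℝ) ^ m * ((1 / m) ^ m * (moment W (indicatorWeight S)).det) := by gcongr
      _ = _ := by rw [← mul_assoc, ← mul_pow, mul_one_div_cancel hm0.ne', one_pow, one_mul]
  linarith

theorem moment_indicatorWeight_image {s : Fin m → Fin n} (hs : W.submatrix id s = 1) :
    Function.Injective s ∧ moment W (indicatorWeight (univ.image s)) = 1 := by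
  have happ : ∀ a l, W a (s l) = if a = l then 1 else 0 := fun a l => by
    have := congrFun (congrFun hs a) l
    rwa [one_apply] at this
  have hinj : Function.Injective s := by
    intro a b hab
    have := happ a b
    rw [← hab, happ a a, if_pos rfl] at this
    by_contra hne
    rw [if_neg hne] at this
    exact one_ne_zero this
  refine ⟨hinj, ?_⟩
  ext a b
  simp only [mul_apply, moment, transpose_apply, diagonal_apply,
    indicatorWeight, mul_ite, mul_one, mul_zero, sum_ite_eq', mem_univ, if_true, ite_mul, zero_mul]
  rw [← sum_filter, filter_mem_eq_inter, univ_inter, sum_image fun _ _ _ _ h => hinj h]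
  simp [happ, one_apply]

end Matrix

/-! ### Correctness and running time of Gram–Schmidt and Frank–Wolfe. -/

namespace RealRAM
open Finset Matrix

/-- The upper left `m × n` part of a real array. -/
def Store.mat (σ : Store) (m n a : ℕ) : Matrix (Fin m) (Fin n) ℝ := of fun l i => σ.realArr a l i

theorem mat_apply (σ : Store) {m n : ℕ} (a : ℕ) (l : Fin m) (i : Fin n) :
    σ.mat m n a l i = σ.realArr a l i := rfl

variable {m n : ℕ} {W : Matrix (Fin m) (Fin n) ℝ} {B M : Matrix (Fin m) (Fin m) ℝ} {σ : Store}

theorem sum_realArr_eq_columnForm (hW : σ.mat m n 0 = W) (hY : σ.mat m n 1 = B * W)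
    (i j : Fin n) :
    ∑ l ∈ range m, σ.realArr 0 l i * σ.realArr 1 l j = columnForm W B i j := by
  rw [sum_range, columnForm_apply, dotProduct]
  refine sum_congr rfl fun l _ => ?_
  have h1 := congrFun (congrFun hW l) i
  have h2 := congrFun (congrFun hY l) j
  rw [mat_apply] at h1 h2
  rw [h1, h2]
  rfl

/-- Pivoted Gram–Schmidt orthogonalization. -/
def gramSchmidt : Program := loop 6 0 pivotStep

/-- The rows of `V` are kept dual to the chosen columns, so at the end array `2` holds `W` in the
basis of these columns, with no separate inversion. -/
theorem wp_gramSchmidt {Z : Matrix (Fin n) (Fin m) ℝ} (hm : 1 ≤ m) (hn : 1 ≤ n)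
    (h0 : σ.natVar 0 = m) (h1 : σ.natVar 1 = n) (hW : σ.mat m n 0 = W) (hY : σ.mat m n 1 = B * W)
    (hf : ∀ i, σ.natArr 1 i = 0) (hB : Bᵀ = B) (hM : M.PosDef) (hBM : B * M = 1)
    (hZ : W * Z = 1) :
    wp gramSchmidt σ fun t τ => t ≤ 600 * (n * m ^ 2) ∧ ∃ P s κ U V,
      GramSchmidt W B M m P s κ U ∧ τ.mat m n 2 = V * W ∧ V * W.submatrix id s = 1 ∧
      ∀ l : Fin m, τ.natArr 0 l = s l := by
  refine (wp_loop (T := 500 * (n * m)) (fun t τ => ∃ P s κ U, ∃ V : Fin m → Fin m → ℝ,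
      GramSchmidt W B M t P s κ U ∧ τ.mat m n 1 = P * W ∧
      (∀ l : Fin m, (l : ℕ) < t → τ.natArr 0 l = s l) ∧
      (∀ l : Fin m, (l : ℕ) < t → ∀ i : Fin n, τ.realArr 2 l i = V l ⬝ᵥ W.col i) ∧
      ∀ l l' : Fin m, (l : ℕ) < t → (l' : ℕ) < t →
        V l ⬝ᵥ W.col (s l') = if l = l' then 1 else 0)
    (by decide) (by decide) (by decide) ?_ ?_).mono ?_
  · exact ⟨B, fun _ => ⟨0, hn⟩, 0, 0, 0, GramSchmidt.init hB hBM _ _, hY, by simp, by simp,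
      by simp⟩
  · rintro t ht τ hF hτ ⟨P, s, κ, U, V, hG, hPW, hs, hV, hδ⟩
    rw [h0] at ht
    have g0 := hF.natVar 0 (by decide)
    have g1 := hF.natVar 1 (by decide)
    have gW := hF.realArr 0 (by decide)
    have gf := hF.natArr 1 (by decide)
    rw [h0] at g0
    rw [h1] at g1
    have hWτ : τ.mat m n 0 = W := by rw [← hW, Store.mat, gW]; rfl
    have hform := sum_realArr_eq_columnForm hWτ hPW
    refine (wp_pivotStep (σ := τ)
      (d := fun i => ∑ l ∈ range m, τ.realArr 0 l i * τ.realArr 1 l i)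
      (g := fun j i => ∑ l ∈ range m, τ.realArr 0 l j * τ.realArr 1 l i)
      (by omega) (by omega) (fun i _ => by rw [g0]) (fun j _ i _ => by rw [g0]) ?_ ?_).mono ?_
    · intro i hi
      rw [g1] at hi
      rw [hform ⟨i, hi⟩ ⟨i, hi⟩]
      exact (hG.posSemidef hM.posSemidef).columnForm_self_nonneg _
    · intro i _
      rw [gf, hf]
    · rintro u υ hFυ ⟨hu, j, hj, hmax, hS, hY', hR, hR'⟩
      rw [g1] at hj hmax hR hR' hu
      rw [g0] at hu hY'
      rw [g1] at hY'
      rw [hτ] at hS hR hR'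
      obtain ⟨j, rfl⟩ : ∃ j' : Fin n, (j' : ℕ) = j := ⟨⟨j, hj⟩, rfl⟩
      have hmax' : ∀ i, columnForm W P i i ≤ columnForm W P j j := fun i => by
        have := hmax i i.2
        rwa [hform, hform] at this
      rw [hform] at hY' hR hR'
      have hR0 : ∀ i : Fin n, υ.realArr 2 t i =
          ((1 / columnForm W P j j) • (P *ᵥ W.col j)) ⬝ᵥ W.col i := fun i => by
        rw [hR i i.2, hform, smul_dotProduct, mulVec_dotProduct hG.symm, ← columnForm_apply,
          smul_eq_mul]
      have hu0 := hG.step hM ht hZ hmax'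
      have hdiag := hu0.diag ⟨t, ht⟩ (Nat.lt_succ_self t)
      have htri := fun l' => hu0.tri ⟨t, ht⟩ l' (Nat.lt_succ_self t)
      simp only [Function.update_self] at hdiag htri
      refine ⟨hu, _, _, _, _, fun l => if l = ⟨t, ht⟩ then
        (1 / columnForm W P j j) • (P *ᵥ W.col j) else V l - (V l ⬝ᵥ W.col j) •
          ((1 / columnForm W P j j) • (P *ᵥ W.col j)), hu0, ?_, ?_, ?_, ?_⟩
      · ext l i
        rw [downdate_mul_apply hG.symm, ← hPW, mat_apply, mat_apply, mat_apply, setNat_realArr,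
          hY' l l.2 i i.2, hform]
      · intro l hl
        rw [setNat_natArr, hS]
        by_cases h : l = ⟨t, ht⟩
        · rw [h, Function.update_self, Function.update_self]
        · have h' : (l : ℕ) ≠ t := fun e => h (Fin.ext e)
          rw [Function.update_of_ne h, Function.update_of_ne h', ← hs l (by omega)]
      · intro l hl i
        rw [setNat_realArr]
        beta_reduce
        by_cases h : l = ⟨t, ht⟩
        · rw [if_pos h, h]
          exact hR0 i
        · have h' : (l : ℕ) ≠ t := fun e => h (Fin.ext e)
          rw [if_neg h, hR' l (by omega) i i.2, hV l (by omega), hV l (by omega), sub_dotProduct,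
            smul_dotProduct, ← hR0 i, hR i i.2, smul_eq_mul]
      · intro l l' hl hl'
        -- The new functional is `1` on the new column and `0` on the earlier ones, so subtracting
        -- its multiples from the old rows keeps them dual.
        have key : ∀ l' : Fin m, (l' : ℕ) < t + 1 →
            ((1 / columnForm W P j j) • (P *ᵥ W.col j)) ⬝ᵥ
              W.col (Function.update s ⟨t, ht⟩ j l') = if l' = ⟨t, ht⟩ then 1 else 0 := by
          intro l' hl'
          split_ifs with h
          · rw [h, Function.update_self]
            exact hdiag
          · have h' : (l' : ℕ) ≠ t := fun e => h (Fin.ext e)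
            exact htri l' (Fin.lt_def.2 (by simp only; omega))
        beta_reduce
        by_cases h : l = ⟨t, ht⟩
        · rw [if_pos h, key l' hl', h]
          simp only [eq_comm]
        · have h1 : (l : ℕ) ≠ t := fun e => h (Fin.ext e)
          rw [if_neg h, sub_dotProduct, smul_dotProduct, key l' hl']
          by_cases h' : l' = ⟨t, ht⟩
          · rw [if_pos h', h', Function.update_self, if_neg h, smul_eq_mul, mul_one, sub_self]
          · have h2 : (l' : ℕ) ≠ t := fun e => h' (Fin.ext e)
            rw [if_neg h', Function.update_of_ne h', hδ l l' (by omega) (by omega), smul_zero,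
              sub_zero]
  · rintro t τ _ ⟨ht, P, s, κ, U, V, hG, -, hs, hV, hδ⟩
    rw [h0] at ht hG hs hV hδ
    refine ⟨?_, P, s, κ, U, of V, hG, ?_, ?_, fun l => hs l l.2⟩
    · have : 1 ≤ n * m := Nat.mul_pos hn hm
      nlinarith
    · ext l i
      exact hV l l.2 i
    · ext l l'
      rw [one_apply]
      exact hδ l l' l.2 l'.2

/-- The Frank–Wolfe algorithm for the maximization of the determinant of the moment matrix. -/
def frankWolfe : Program :=
  .seq argmax (.while (.realLt (.mul (.mul (.var 0) (.var 0)) (.ofNat (.var 0))) (.var 1))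
    (.seq (.setReal 5 (.sub (.div (.ofNat (.const 1)) (.ofNat (.var 0)))
        (.div (.ofNat (.const 1)) (.var 1))))
      (.seq (.setReal 3 (.add (.ofNat (.const 1)) (.var 5)))
        (.seq (.setReal 4 (.div (.var 5) (.add (.ofNat (.const 1)) (.mul (.var 5) (.var 1)))))
          (.seq update argmax)))))

theorem wp_argmax_columnForm (hm : 1 ≤ m) (hn : 1 ≤ n) (h0 : σ.natVar 0 = m) (h1 : σ.natVar 1 = n)
    (hW : σ.mat m n 0 = W) (hY : σ.mat m n 1 = B * W) (hB : B.PosSemidef)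
    (hf : ∃ i : Fin n, σ.natArr 1 i = 0) :
    wp argmax σ fun t τ => t ≤ 100 * (n * m) ∧ ∃ j : Fin n, τ.natVar 5 = j ∧ σ.natArr 1 j = 0 ∧
      τ.realVar 1 = columnForm W B j j ∧
      ∀ i : Fin n, σ.natArr 1 i = 0 → columnForm W B i i ≤ columnForm W B j j := by
  have hform := sum_realArr_eq_columnForm hW hY
  refine (wp_argmax (d := fun i => ∑ l ∈ range m, σ.realArr 0 l i * σ.realArr 1 l i)
    (by omega) (by omega) (fun i _ => by rw [h0]) ?_ ?_).mono ?_
  · intro i hi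
    rw [h1] at hi
    have := hform ⟨i, hi⟩ ⟨i, hi⟩
    simp only at this
    rw [this]
    exact hB.columnForm_self_nonneg _
  · obtain ⟨i, hi⟩ := hf
    exact ⟨i, by omega, hi⟩
  · rintro t τ _ ⟨ht, hj, hfj, hκ, hmax⟩
    rw [h1] at ht hj hmax
    rw [h0] at ht
    refine ⟨ht, ⟨τ.natVar 5, hj⟩, rfl, hfj, ?_, fun i hi => ?_⟩
    · rw [hκ]
      exact hform ⟨_, hj⟩ ⟨_, hj⟩
    · have := hmax i i.2 hi
      rw [hform] at this
      exact this.trans_eq (hform ⟨_, hj⟩ ⟨_, hj⟩)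

theorem wp_update_downdate (hm : 1 ≤ m) (hn : 1 ≤ n) (h0 : σ.natVar 0 = m) (h1 : σ.natVar 1 = n)
    (hW : σ.mat m n 0 = W) (hY : σ.mat m n 1 = B * W) (hB : Bᵀ = B) {j : Fin n}
    (hj : σ.natVar 5 = j) :
    wp update σ fun t τ => t ≤ 200 * (n * m) ∧
      τ.mat m n 1 = (σ.realVar 3 • downdate B (W.col j) (σ.realVar 4)) * W := by
  have hform := sum_realArr_eq_columnForm hW hY
  refine (wp_update (g := fun i => ∑ l ∈ range m, σ.realArr 0 l j * σ.realArr 1 l i)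
    (by omega) (by omega) (by omega) (fun i _ => by rw [h0, hj])).mono ?_
  rintro t τ _ ⟨ht, -, h⟩
  rw [h0, h1] at ht
  rw [h0, h1] at h
  refine ⟨ht, ?_⟩
  ext l i
  rw [Matrix.smul_mul, Matrix.smul_apply, downdate_mul_apply hB, ← hY, mat_apply, mat_apply,
    mat_apply, h l l.2 i i.2, hform, hj, smul_eq_mul]

/-- The weight `p` exists only in the invariant; the program stores just `B W`, where `B` inverts
the current moment matrix. -/
theorem wp_frankWolfe {p : Fin n → ℝ} {c D : ℝ} (hm : 1 ≤ m) (hn : 1 ≤ n) (hc : 1 < c)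
    (h0 : σ.natVar 0 = m) (h1 : σ.natVar 1 = n) (hc0 : σ.realVar 0 = c) (hW : σ.mat m n 0 = W)
    (hY : σ.mat m n 1 = B * W) (hf : ∀ i, σ.natArr 1 i = 0) (hp : IsWeight p)
    (hB : B * moment W p = 1) (hD : ∀ p, IsWeight p → (moment W p).det ≤ D) {v : ℕ}
    (hv : m * (potential (2 * Real.log c) (gap W p) - potential (2 * Real.log c) 0) ≤ v) :
    wp frankWolfe σ fun t τ => t ≤ (v + 1) * (500 * (n * m)) ∧ ∃ p B, IsWeight p ∧
      B * moment W p = 1 ∧ τ.mat m n 1 = B * W ∧ ∀ i, columnForm W B i i ≤ c ^ 2 * m := by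
  have hm0 : (0 : ℝ) < m := by exact_mod_cast hm
  have hη : 0 < 2 * Real.log c := by have := Real.log_pos hc; linarith
  have hnm : 1 ≤ n * m := Nat.mul_pos hn hm
  apply wp_seq
  refine (wp_argmax_columnForm hm hn h0 h1 hW hY (posSemidef_of_mul_moment hp.1 hB)
    ⟨⟨0, hn⟩, hf _⟩).mono ?_
  rintro t1 τ hF ⟨ht1, j, hj, -, hκ, hmax⟩
  -- The variant bounds `m` times the potential above its value at gap `0`; every iteration lowers
  -- this quantity by at least `1`.
  refine (wp_while (T := 300 * (n * m) + 50)
    (fun v τ => τ.natVar 0 = m ∧ τ.natVar 1 = n ∧ τ.realVar 0 = c ∧ τ.mat m n 0 = W ∧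
      (∀ i, τ.natArr 1 i = 0) ∧ ∃ p B, IsWeight p ∧ B * moment W p = 1 ∧ τ.mat m n 1 = B * W ∧
      m * (potential (2 * Real.log c) (gap W p) - potential (2 * Real.log c) 0) ≤ v ∧
      ∃ j : Fin n, τ.natVar 5 = j ∧ τ.realVar 1 = columnForm W B j j ∧
        ∀ i, columnForm W B i i ≤ columnForm W B j j) ?_ v τ ?_).mono ?_
  · rintro v τ ⟨h0, h1, hc0, hW, hf, p, B, hp, hB, hY, hv, j, hj, hκ, hmax⟩ hb
    simp only [BExp.eval, RExp.eval, NExp.eval, h0, hc0, hκ] at hb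
    have hc2 : 1 < c * c := by nlinarith
    have hmκ : (m : ℝ) < columnForm W B j j := by nlinarith
    have hκ0 : 0 < columnForm W B j j := hm0.trans hmκ
    have hs : 0 ≤ 1 / (m : ℝ) - 1 / columnForm W B j j :=
      (sub_pos.2 (one_div_lt_one_div_of_lt hm0 hmκ)).le
    apply wp_seq
    apply wp_setReal
    apply wp_seq
    apply wp_setReal
    apply wp_seq
    apply wp_setReal
    apply wp_seq
    simp only [NExp.eval, RExp.eval, NExp.cost, RExp.cost, setReal_realVar, h0,
      Nat.reduceEqDiff, if_false, if_true, Nat.cast_one, hκ]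
    generalize hτ' : ((τ.setReal 5 (1 / (m : ℝ) - 1 / columnForm W B j j)).setReal 3
      (1 + (1 / (m : ℝ) - 1 / columnForm W B j j))).setReal 4 _ = τ'
    have e0 : τ'.natVar 0 = m := by simp [← hτ', h0]
    have e1 : τ'.natVar 1 = n := by simp [← hτ', h1]
    have e5 : τ'.natVar 5 = j := by simp [← hτ', hj]
    have ec : τ'.realVar 0 = c := by simp [← hτ', hc0]
    have eW : τ'.mat m n 0 = W := by simp [← hτ', ← hW, Store.mat]
    have eY : τ'.mat m n 1 = B * W := by simp [← hτ', ← hY, Store.mat]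
    have ef : ∀ i, τ'.natArr 1 i = 0 := by simp [← hτ', hf]
    have e3 : τ'.realVar 3 = 1 + (1 / (m : ℝ) - 1 / columnForm W B j j) := by simp [← hτ']
    have e4 : τ'.realVar 4 = (1 / (m : ℝ) - 1 / columnForm W B j j) /
      (1 + (1 / (m : ℝ) - 1 / columnForm W B j j) * columnForm W B j j) := by simp [← hτ']
    refine (wp_update_downdate hm hn e0 e1 eW eY (transpose_of_mul_moment hp.1 hB) e5).mono ?_
    rintro t2 υ hF2 ⟨ht2, hY'⟩
    rw [e3, e4] at hY'
    have g0 := (hF2.natVar 0 (by decide)).trans e0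
    have g1 := (hF2.natVar 1 (by decide)).trans e1
    have gc := (hF2.realVar 0 (by decide)).trans ec
    have gW : υ.mat m n 0 = W := by rw [← eW, Store.mat, hF2.realArr 0 (by decide)]; rfl
    have gf : ∀ i, υ.natArr 1 i = 0 := fun i => by rw [hF2.natArr 1 (by decide), ef]
    have hp' := hp.shiftWeight j hs
    have hB' := mul_moment_shiftWeight hp hB j hs
    refine (wp_argmax_columnForm hm hn g0 g1 gW hY' (posSemidef_of_mul_moment hp'.1 hB')
      ⟨⟨0, hn⟩, gf _⟩).mono ?_
    rintro t3 ω hF3 ⟨ht3, j', hj', -, hκ', hmax'⟩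
    have hgap := gap_shiftWeight_le hm hp hB hmκ
    have hstep := potential_step hη (by positivity : 0 ≤ 1 / (m : ℝ)) (gap_nonneg hD hp' hB')
      (gap_le_log hD hm hp hB hκ0 hmax) ?_ hgap
    · have hnn := potential_mono hη le_rfl (gap_nonneg hD hp' hB')
      have hv' : m * (potential (2 * Real.log c) (gap W
          (shiftWeight p j (1 / m - 1 / columnForm W B j j))) - potential (2 * Real.log c) 0) + 1 ≤
          v := by
        refine le_trans ?_ hv
        have := mul_le_mul_of_nonneg_left hstep hm0.le
        rw [mul_add, mul_one_div_cancel hm0.ne'] at this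
        linarith
      have hv1 : 1 ≤ v := by
        have : (1 : ℝ) ≤ v := by
          refine le_trans ?_ hv'
          have := mul_nonneg hm0.le (sub_nonneg.2 hnn)
          linarith
        exact_mod_cast this
      refine ⟨by omega, v - 1, by omega, (hF3.natVar 0 (by decide)).trans g0,
        (hF3.natVar 1 (by decide)).trans g1, (hF3.realVar 0 (by decide)).trans gc, ?_, ?_, _, _,
        hp', hB', ?_, ?_, j', hj', hκ', fun i => hmax' i (gf i)⟩
      · rw [← gW, Store.mat, hF3.realArr 0 (by decide)]; rfl
      · intro i
        rw [hF3.natArr 1 (by decide), gf]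
      · rw [← hY', Store.mat, hF3.realArr 1 (by decide)]; rfl
      · rw [Nat.cast_sub hv1, Nat.cast_one]
        linarith
    -- The loop test supplies the condition `η ≤ h` for `η = 2 log c`.
    · have : 2 * Real.log c = Real.log (c * c) := by
        rw [Real.log_mul (by linarith) (by linarith)]; ring
      rw [this]
      refine Real.log_le_log (by linarith) ?_
      rw [le_div_iff₀ hm0]
      exact hb.le
  · refine ⟨(hF.natVar 0 (by decide)).trans h0,
        (hF.natVar 1 (by decide)).trans h1, (hF.realVar 0 (by decide)).trans hc0, ?_, ?_, p, B,
        hp, hB, ?_, hv, j, hj, hκ, fun i => hmax i (hf i)⟩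
    · rw [← hW, Store.mat, hF.realArr 0 (by decide)]; rfl
    · intro i
      rw [hF.natArr 1 (by decide), hf]
    · rw [← hY, Store.mat, hF.realArr 1 (by decide)]; rfl
  · rintro t2 υ _ ⟨ht2, ⟨v', h0, _, hc0, _, _, p, B, hp, hB, hY, _, j, _, hκ, hmax⟩, hb⟩
    simp only [BExp.eval, RExp.eval, NExp.eval, h0, hc0, hκ, not_lt] at hb
    refine ⟨?_, p, B, hp, hB, hY, fun i => (hmax i).trans (hb.trans_eq (by ring))⟩
    simp only [BExp.cost, RExp.cost, NExp.cost] at ht2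
    nlinarith

end RealRAM

/-! ### Greedy extension to `k` columns. -/

namespace RealRAM
open Finset Matrix

variable {m n : ℕ} {W : Matrix (Fin m) (Fin n) ℝ} {B M : Matrix (Fin m) (Fin m) ℝ} {σ : Store}

theorem wp_rescale_mat {src : ℕ} (hs : src ≠ 1) (hm : 1 ≤ m) (hn : 1 ≤ n) (h0 : σ.natVar 0 = m)
    (h1 : σ.natVar 1 = n) (hW : σ.mat m n src = W) :
    wp (rescale src) σ fun t τ => t ≤ 100 * (n * m) ∧ τ.mat m n 0 = W ∧
      τ.mat m n 1 = (σ.realVar 3 • 1 : Matrix (Fin m) (Fin m) ℝ) * W := by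
  refine (wp_rescale hs (by omega) (by omega)).mono ?_
  rintro t τ _ ⟨ht, h⟩
  rw [h0, h1] at ht h
  refine ⟨ht, ?_, ?_⟩
  · ext l i
    rw [← hW]
    exact (h l l.2 i i.2).1
  · ext l i
    rw [Matrix.smul_mul, Matrix.one_mul, ← hW]
    exact (h l l.2 i i.2).2

/-- Flag the first `m` entries of the output list. -/
def flagChosen : Program := loop 6 0 (.setNatArr 1 (.arr 0 (.var 6)) (.const 1))

theorem wp_flagChosen (h0 : σ.natVar 0 = m) (hf : ∀ i, σ.natArr 1 i = 0) :
    wp flagChosen σ fun t τ => t ≤ 20 * m + 10 ∧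
      ∀ i, τ.natArr 1 i = 0 ↔ ∀ l < m, σ.natArr 0 l ≠ i := by
  refine (wp_loop (T := 4) (fun k τ => ∀ i, τ.natArr 1 i = 0 ↔ ∀ l < k, σ.natArr 0 l ≠ i)
    (by decide) (by decide) (by decide) (by simp [hf]) ?_).mono ?_
  · intro k hk τ hF hτ hI
    have hS := hF.natArr 0 (by decide)
    apply wp_setNatArr
    simp only [NExp.cost, NExp.eval, hτ, hS, setNat_natArr, setNatArr_natArr, true_and]
    refine ⟨by omega, fun i => ?_⟩
    constructor
    · intro h l hl
      split_ifs at h with hi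
      rcases Nat.lt_succ_iff_lt_or_eq.1 hl with h' | h'
      · exact (hI i).1 h l h'
      · rw [h']; exact fun e => hi e.symm
    · intro h
      rw [if_neg fun e => h k (Nat.lt_succ_self k) e.symm]
      exact (hI i).2 fun l hl => h l (by omega)
  · rintro t τ _ ⟨ht, h⟩
    rw [h0] at ht h
    exact ⟨by omega, h⟩

/-- Extend the list of columns greedily to `k` columns. -/
def extend : Program :=
  .seq (.setNat 6 (.var 0)) (.while (.natLt (.var 6) (.var 2))
    (.seq argmax (.seq (.setReal 3 (.ofNat (.const 1)))
      (.seq (.setReal 4 (.div (.ofNat (.const 1)) (.add (.ofNat (.const 1)) (.var 1))))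
        (.seq update (.seq (.setNatArr 0 (.var 6) (.var 5)) (.seq (.setNatArr 1 (.var 5) (.const 1))
          (.setNat 6 (.add (.var 6) (.const 1))))))))))

/-- The first `t` output entries list the set `S`, which has `t` elements. -/
structure Lists (τ : Store) (t : ℕ) (S : Finset (Fin n)) : Prop where
  card : S.card = t
  lt : ∀ l < t, τ.natArr 0 l < n
  mem_iff : ∀ i : Fin n, i ∈ S ↔ ∃ l < t, τ.natArr 0 l = i

/-- The list has no repetition because its image has as many elements as the list has positions. -/
theorem Lists.outputs {τ : Store} {t : ℕ} {S : Finset (Fin n)} (h : Lists τ t S) :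
    Outputs τ S := by
  obtain ⟨rfl, h1, h2⟩ := h
  have him : univ.image (fun l : Fin S.card => (⟨τ.natArr 0 l, h1 l l.2⟩ : Fin n)) = S := by
    ext i
    rw [h2 i, mem_image]
    constructor
    · rintro ⟨l, -, rfl⟩
      exact ⟨l, l.2, rfl⟩
    · rintro ⟨l, hl, hi⟩
      exact ⟨⟨l, hl⟩, mem_univ _, Fin.ext hi⟩
  refine ⟨_, ?_, him, fun _ => rfl⟩
  rw [← Set.injOn_univ, ← coe_univ]
  exact card_image_iff.1 (by rw [him, card_univ, Fintype.card_fin])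

theorem wp_extend {k : ℕ} {p : Fin n → ℝ} {S₀ : Finset (Fin n)} (hm : 1 ≤ m) (hmk : m ≤ k)
    (hkm : k ≤ 2 * m) (hkn : k ≤ n)
    (h0 : σ.natVar 0 = m) (h1 : σ.natVar 1 = n) (h2 : σ.natVar 2 = k) (hW : σ.mat m n 0 = W)
    (hY : σ.mat m n 1 = B * W) (hB : B * moment W (indicatorWeight S₀) = 1)
    (hS : Lists σ m S₀) (hf : ∀ i : Fin n, σ.natArr 1 i = 0 ↔ i ∉ S₀) (hp : IsWeight p)
    (hdet : m.factorial * (moment W p).det ≤ (moment W (indicatorWeight S₀)).det) :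
    wp extend σ fun t τ => t ≤ 500 * (n * m ^ 2) ∧ ∃ S, Lists τ k S ∧
      ((m : ℝ) ^ m * (moment W p).det ≤ (moment W (indicatorWeight S)).det ∨
        2 ^ (k - m) * m.factorial * (moment W p).det ≤ (moment W (indicatorWeight S)).det) := by
  have hnm : 1 ≤ n * m := Nat.mul_pos (by omega) hm
  apply wp_seq
  apply wp_setNat
  simp only [NExp.eval, h0, NExp.cost]
  refine (wp_while (T := 300 * (n * m) + 50)
    (fun v τ => τ.natVar 0 = m ∧ τ.natVar 1 = n ∧ τ.natVar 2 = k ∧ τ.mat m n 0 = W ∧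
      τ.natVar 6 + v = k ∧ ∃ S B, Lists τ (τ.natVar 6) S ∧
      B * moment W (indicatorWeight S) = 1 ∧ τ.mat m n 1 = B * W ∧
      (∀ i : Fin n, τ.natArr 1 i = 0 ↔ i ∉ S) ∧ m ≤ τ.natVar 6 ∧
      ((m : ℝ) ^ m * (moment W p).det ≤ (moment W (indicatorWeight S)).det ∨
        2 ^ (τ.natVar 6 - m) * m.factorial * (moment W p).det ≤
          (moment W (indicatorWeight S)).det)) ?_ (k - m) (σ.setNat 6 m) ?_).mono ?_
  · rintro v τ ⟨h0, h1, h2, hW, hv, S, B, hS, hB, hY, hf, hmt, hdet⟩ hb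
    simp only [BExp.eval, NExp.eval, h2] at hb
    obtain ⟨t, ht⟩ : ∃ t, τ.natVar 6 = t := ⟨_, rfl⟩
    rw [ht] at hb hS hdet hv hmt
    obtain ⟨i₀, hi₀⟩ : ∃ i, i ∉ S := by
      by_contra! hc
      have := card_le_card (fun i _ => hc i : (univ : Finset (Fin n)) ⊆ S)
      rw [card_univ, Fintype.card_fin, hS.card] at this
      omega
    have hq := indicatorWeight_nonneg S
    have hBp := posSemidef_of_mul_moment hq hB
    apply wp_seq
    refine (wp_argmax_columnForm hm (by omega) h0 h1 hW hY hBp ⟨i₀, (hf i₀).2 hi₀⟩).mono ?_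
    rintro t1 υ hF ⟨ht1, j, hj, hfj, hκ, hmax⟩
    have hjS := (hf j).1 hfj
    have f0 := (hF.natVar 0 (by decide)).trans h0
    have f1 := (hF.natVar 1 (by decide)).trans h1
    have f2 := (hF.natVar 2 (by decide)).trans h2
    have f6 := (hF.natVar 6 (by decide)).trans ht
    have fW : υ.mat m n 0 = W := by rw [← hW, Store.mat, hF.realArr 0 (by decide)]; rfl
    have fY : υ.mat m n 1 = B * W := by rw [← hY, Store.mat, hF.realArr 1 (by decide)]; rfl
    have fS := hF.natArr 0 (by decide)
    have ff := hF.natArr 1 (by decide)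
    apply wp_seq
    apply wp_setReal
    apply wp_seq
    apply wp_setReal
    apply wp_seq
    simp only [NExp.eval, RExp.eval, NExp.cost, RExp.cost, setReal_realVar,
      Nat.reduceEqDiff, if_false, Nat.cast_one, hκ]
    generalize hτ' : (υ.setReal 3 1).setReal 4 _ = τ'
    have e0 : τ'.natVar 0 = m := by simp [← hτ', f0]
    have e1 : τ'.natVar 1 = n := by simp [← hτ', f1]
    have e2 : τ'.natVar 2 = k := by simp [← hτ', f2]
    have e6 : τ'.natVar 6 = t := by simp [← hτ', f6]
    have e5 : τ'.natVar 5 = j := by simp [← hτ', hj]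
    have eW : τ'.mat m n 0 = W := by simp [← hτ', ← fW, Store.mat]
    have eY : τ'.mat m n 1 = B * W := by simp [← hτ', ← fY, Store.mat]
    have eS : τ'.natArr 0 = τ.natArr 0 := by simp [← hτ', fS]
    have ef : τ'.natArr 1 = τ.natArr 1 := by simp [← hτ', ff]
    have e3 : τ'.realVar 3 = 1 := by simp [← hτ']
    have e4 : τ'.realVar 4 = 1 / (1 + 1 * columnForm W B j j) := by simp [← hτ']
    refine (wp_update_downdate hm (by omega) e0 e1 eW eY (transpose_of_mul_moment hq hB) e5).mono ?_
    rintro t2 ω hF2 ⟨ht2, hY'⟩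
    rw [e3, e4, one_smul] at hY'
    have g0 := (hF2.natVar 0 (by decide)).trans e0
    have g1 := (hF2.natVar 1 (by decide)).trans e1
    have g2 := (hF2.natVar 2 (by decide)).trans e2
    have g5 := (hF2.natVar 5 (by decide)).trans e5
    have g6 := (hF2.natVar 6 (by decide)).trans e6
    have gW : ω.mat m n 0 = W := by rw [← eW, Store.mat, hF2.realArr 0 (by decide)]; rfl
    have gS := (hF2.natArr 0 (by decide)).trans eS
    have gf := (hF2.natArr 1 (by decide)).trans ef
    apply wp_seq
    apply wp_setNatArr
    apply wp_seq
    apply wp_setNatArr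
    apply wp_setNat
    have hκ0 := hBp.columnForm_self_nonneg (W := W) j
    have hB' : downdate B (W.col j) (1 / (1 + 1 * columnForm W B j j)) *
        moment W (indicatorWeight (insert j S)) = 1 := by
      rw [moment_indicatorWeight_insert hjS]
      exact downdate_mul_add (transpose_of_mul_moment hq hB) hB (W.col j)
        (by rw [← columnForm_apply]; positivity)
    have hdet' := det_add_smul_vecMulVec hB (W.col j) 1
    rw [← moment_indicatorWeight_insert hjS, ← columnForm_apply, one_mul] at hdet'
    have hpos := det_pos_of_mul_moment hq hB
    simp only [NExp.eval, NExp.cost, setNatArr_natVar, g5, g6, setNat_natVar, if_true,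
      Nat.reduceEqDiff, if_false, setNat_natArr]
    refine ⟨by omega, v - 1, by omega, g0, g1, g2, gW, by omega, insert j S, _, ⟨?_, ?_, ?_⟩, hB',
      hY', ?_, by omega, ?_⟩
    · rw [card_insert_of_notMem hjS, hS.card]
    · intro l hl
      simp only [setNat_natArr, setNatArr_natArr, zero_ne_one, false_and, if_false, true_and, gS]
      split_ifs with h
      · exact j.2
      · exact hS.lt l (by omega)
    · intro i
      simp only [setNat_natArr, setNatArr_natArr, zero_ne_one, false_and, if_false, true_and, gS,
        mem_insert, hS.mem_iff]
      constructor
      · rintro (rfl | ⟨l, hl, hi⟩)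
        · exact ⟨t, by omega, by simp⟩
        · exact ⟨l, by omega, by rw [if_neg (by omega), hi]⟩
      · rintro ⟨l, hl, hi⟩
        split_ifs at hi with h
        · exact Or.inl (Fin.ext hi.symm)
        · exact Or.inr ⟨l, by omega, hi⟩
    · intro i
      simp only [setNatArr_natArr, one_ne_zero, false_and, if_false, true_and, gf, mem_insert]
      by_cases h : i = j
      · simp [h]
      · rw [if_neg fun e => h (Fin.ext e), hf i]
        simp [h]
    · rw [hdet']
      -- Below the threshold the factor `1 + κ` exceeds `2`; above it the determinant at least does
      -- not decrease, so the first alternative persists.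
      by_cases hlt : (moment W (indicatorWeight S)).det < (m : ℝ) ^ m * (moment W p).det
      · right
        obtain ⟨i, hi, hi1⟩ := exists_one_lt_columnForm hm hB hp hlt
        have h1 : 1 < columnForm W B j j := hi1.trans_le (hmax i ((hf i).2 hi))
        have h3 := hdet.resolve_left (not_le.2 hlt)
        rw [show t + 1 - m = (t - m) + 1 by omega, pow_succ]
        nlinarith
      · left
        have h3 := not_lt.1 hlt
        nlinarith
  · refine ⟨h0, h1, h2, hW, by simp; omega, S₀, B, ?_, hB, hY, hf, ?_, ?_⟩
    · simp only [setNat_natVar, if_true]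
      exact ⟨hS.card, hS.lt, hS.mem_iff⟩
    · simp
    · right
      simpa using hdet
  · rintro t τ _ ⟨ht, ⟨v, h0, h1, h2, hW, hv, S, B, hS, _, _, _, _, hdet⟩, hb⟩
    simp only [BExp.eval, NExp.eval, h2] at hb
    have h6 : τ.natVar 6 = k := by omega
    rw [h6] at hS hdet
    refine ⟨?_, S, hS, hdet⟩
    simp only [BExp.cost, NExp.cost] at ht
    -- At most `m` columns are added, since `k ≤ 2m`.
    have : (k - m) * (300 * (n * m) + 50 + (1 + 1 + 1) + 1) ≤
        m * (300 * (n * m) + 50 + (1 + 1 + 1) + 1) := Nat.mul_le_mul_right _ (by omega)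
    nlinarith

end RealRAM

/-! ### The complete algorithm and the volume bound. -/

namespace RealRAM
open Finset Matrix

variable {m n : ℕ}

theorem exists_right_inverse_of_rank_eq {X : Matrix (Fin m) (Fin n) ℝ} (h : X.rank = m) :
    ∃ Z : Matrix (Fin n) (Fin m) ℝ, X * Z = 1 := by
  apply Matrix.mulVec_surjective_iff_exists_right_inverse.1
  have : LinearMap.range X.mulVecLin = ⊤ := by
    apply Submodule.eq_top_of_finrank_eq
    rw [Module.finrank_fin_fun]
    exact h
  exact LinearMap.range_eq_top.1 this

/-- Column subset selection by approximate optimal design and greedy rounding. -/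
def selectColumns : Program :=
  .seq (.setReal 3 (.ofNat (.const 1))) (.seq (rescale 0) (.seq gramSchmidt
    (.seq (.setReal 3 (.ofNat (.var 0))) (.seq (rescale 2) (.seq frankWolfe (.seq gramSchmidt
      (.seq (.setReal 3 (.ofNat (.const 1))) (.seq (rescale 2) (.seq flagChosen extend)))))))))

/-- In coordinates where the chosen columns are the standard basis, the uniform weight on them has
moment matrix `m⁻¹ • 1`, of determinant `m^(-m)`, while the optimum is at most `1`. -/
theorem uniformWeight_spec {W : Matrix (Fin m) (Fin n) ℝ} {s : Fin m → Fin n} (hm : 1 ≤ m)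
    (hs : W.submatrix id s = 1) (hD : ∀ p, IsWeight p → (moment W p).det ≤ 1) :
    ∃ p, IsWeight p ∧ ((m : ℝ) • 1 : Matrix (Fin m) (Fin m) ℝ) * moment W p = 1 ∧
      gap W p ≤ Real.log m := by
  obtain ⟨hinj, hmom⟩ := moment_indicatorWeight_image hs
  have hm0 : (0 : ℝ) < m := by exact_mod_cast hm
  have hp : IsWeight ((m : ℝ)⁻¹ • indicatorWeight (univ.image s)) := by
    refine ⟨fun i => ?_, ?_⟩
    · have := indicatorWeight_nonneg (univ.image s) i
      simp only [Pi.zero_apply, Pi.smul_apply, smul_eq_mul] at *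
      positivity
    · simp only [Pi.smul_apply, smul_eq_mul, ← mul_sum, indicatorWeight, sum_boole,
        filter_mem_eq_inter, univ_inter, card_image_of_injective _ hinj, card_univ,
        Fintype.card_fin]
      exact inv_mul_cancel₀ hm0.ne'
  have hB : ((m : ℝ) • 1 : Matrix (Fin m) (Fin m) ℝ) *
      moment W ((m : ℝ)⁻¹ • indicatorWeight (univ.image s)) = 1 := by
    rw [moment_smul, hmom, Matrix.smul_mul, Matrix.mul_smul, smul_smul, mul_inv_cancel₀ hm0.ne',
      Matrix.one_mul, one_smul]
  refine ⟨_, hp, hB, ?_⟩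
  have hopt := det_moment_le_optimalDet hD hp
  have hopt1 : optimalDet W ≤ 1 := csSup_le ⟨_, _, hp, rfl⟩ (by rintro _ ⟨q, hq, rfl⟩; exact hD q hq)
  have h1 := Real.log_nonpos ((det_pos_of_mul_moment hp.1 hB).le.trans hopt) hopt1
  rw [gap, div_le_iff₀ hm0, moment_smul, hmom, det_smul, det_one, mul_one, Fintype.card_fin,
    Real.log_pow, Real.log_inv]
  linarith

theorem wp_selectColumns {k : ℕ} {c : ℝ} {X : Matrix (Fin m) (Fin n) ℝ} (hm : 1 ≤ m)
    (hrank : X.rank = m) (hmk : m ≤ k) (hkm : k ≤ 2 * m - 1) (hkn : k ≤ n) (hc : 1 < c) {v : ℕ}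
    (hv : m * (8 * max 1 (Real.log (Real.log m)) + 20 / (2 * Real.log c)) ≤ v) :
    wp selectColumns (input X k c) fun t τ => t ≤ (v + 1) * (500 * (n * m)) + 3000 * (n * m ^ 2) ∧
      ∃ S : Finset (Fin n), Outputs τ S ∧ S.card = k ∧ ∃ d > 0,
        ((m : ℝ) ^ m * d ≤ (moment X (indicatorWeight S)).det ∨
          2 ^ (k - m) * m.factorial * d ≤ (moment X (indicatorWeight S)).det) ∧
        ∀ T : Finset (Fin n), T.card = k →
          (moment X (indicatorWeight T)).det ≤ (k * c ^ 2) ^ m * d := by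
  have hn : 1 ≤ n := by omega
  have hm0 : (0 : ℝ) < m := by exact_mod_cast hm
  obtain ⟨Z, hZ⟩ := exists_right_inverse_of_rank_eq hrank
  apply wp_seq
  apply wp_setReal
  apply wp_seq
  have hX : (input X k c).mat m n 0 = X := by
    ext l i
    simp [mat_apply, input]
  simp only [RExp.eval, NExp.eval, Nat.cast_one, RExp.cost, NExp.cost]
  generalize hσ : (input X k c).setReal 3 1 = σ
  have a0 : σ.natVar 0 = m := by simp [← hσ, input]
  have a1 : σ.natVar 1 = n := by simp [← hσ, input]
  have a2 : σ.natVar 2 = k := by simp [← hσ, input]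
  have ac : σ.realVar 0 = c := by simp [← hσ, input]
  have af : ∀ i, σ.natArr 1 i = 0 := by simp [← hσ, input]
  have aX : σ.mat m n 0 = X := by rw [← hX, ← hσ]; rfl
  have a3 : σ.realVar 3 = 1 := by simp [← hσ]
  clear hσ hX
  refine (wp_rescale_mat (by decide) hm hn a0 a1 aX).mono ?_
  rintro t1 τ hF ⟨ht1, bW, bY⟩
  rw [a3, one_smul] at bY
  have b0 := (hF.natVar 0 (by decide)).trans a0
  have b1 := (hF.natVar 1 (by decide)).trans a1
  have b2 := (hF.natVar 2 (by decide)).trans a2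
  have bc := (hF.realVar 0 (by decide)).trans ac
  have bf : ∀ i, τ.natArr 1 i = 0 := fun i => by rw [hF.natArr 1 (by decide), af]
  clear hF a0 a1 a2 ac af aX a3
  apply wp_seq
  refine (wp_gramSchmidt hm hn b0 b1 bW bY bf transpose_one PosDef.one (Matrix.one_mul 1)
    hZ).mono ?_
  rintro t2 υ hF ⟨ht2, P₁, s₁, κ₁, U₁, V₁, hG₁, cR, hV₁, -⟩
  have c0 := (hF.natVar 0 (by decide)).trans b0
  have c1 := (hF.natVar 1 (by decide)).trans b1
  have c2 := (hF.natVar 2 (by decide)).trans b2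
  have cc := (hF.realVar 0 (by decide)).trans bc
  have cf : ∀ i, υ.natArr 1 i = 0 := fun i => by rw [hF.natArr 1 (by decide), bf]
  clear hF b0 b1 b2 bc bf bW bY
  have hdet₁ : V₁.det * (X.submatrix id s₁).det = 1 := by rw [← det_mul, hV₁, det_one]
  have hs₁ : (V₁ * X).submatrix id s₁ = 1 := hV₁
  have hD : ∀ p, IsWeight p → (moment (V₁ * X) p).det ≤ 1 := by
    intro p hp
    rw [det_moment_mul]
    have := mul_le_mul_of_nonneg_left (hG₁.det_moment_le hm hp) (sq_nonneg V₁.det)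
    rwa [← mul_pow, hdet₁, one_pow] at this
  obtain ⟨p₀, hp₀, hB₀, hgap⟩ := uniformWeight_spec hm hs₁ hD
  have hV₁' : V₁ * X * (Z * V₁⁻¹) = 1 := by
    rw [Matrix.mul_assoc, ← Matrix.mul_assoc X, hZ, Matrix.one_mul,
      mul_nonsing_inv _ (IsUnit.of_mul_eq_one _ hdet₁)]
  have ht₁ : 0 < V₁.det ^ 2 := by
    have : V₁.det ≠ 0 := left_ne_zero_of_mul_eq_one hdet₁
    positivity
  apply wp_seq
  apply wp_setReal
  apply wp_seq
  simp only [RExp.eval, NExp.eval, c0, RExp.cost, NExp.cost]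
  refine (wp_rescale_mat (σ := υ.setReal 3 m) (by decide) hm hn c0 c1 cR).mono ?_
  rintro t3 ω hF ⟨ht3, dW, dY⟩
  simp only [setReal_realVar, if_true] at dY
  have d0 := (hF.natVar 0 (by decide)).trans c0
  have d1 := (hF.natVar 1 (by decide)).trans c1
  have d2 := (hF.natVar 2 (by decide)).trans c2
  have dc := (hF.realVar 0 (by decide)).trans cc
  have df : ∀ i, ω.natArr 1 i = 0 := fun i => by
    rw [hF.natArr 1 (by decide), setReal_natArr, cf]
  clear hF c0 c1 c2 cc cf cR
  apply wp_seq
  have hη : 0 < 2 * Real.log c := by have := Real.log_pos hc; linarith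
  refine (wp_frankWolfe hm hn hc d0 d1 dc dW dY df hp₀ hB₀ hD (v := v) ?_).mono ?_
  · refine le_trans ?_ hv
    exact mul_le_mul_of_nonneg_left (potential_sub_le hη (gap_nonneg hD hp₀ hB₀) hgap) hm0.le
  rintro t4 ρ hF ⟨ht4, p, B, hp, hB, eY, hmax⟩
  have e0 := (hF.natVar 0 (by decide)).trans d0
  have e1 := (hF.natVar 1 (by decide)).trans d1
  have e2 := (hF.natVar 2 (by decide)).trans d2
  have eW : ρ.mat m n 0 = V₁ * X := by rw [← dW, Store.mat, hF.realArr 0 (by decide)]; rfl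
  have ef : ∀ i, ρ.natArr 1 i = 0 := fun i => by rw [hF.natArr 1 (by decide), df]
  clear hF d0 d1 d2 dc df dW dY
  apply wp_seq
  refine (wp_gramSchmidt hm hn e0 e1 eW eY ef (transpose_of_mul_moment hp.1 hB)
    (posDef_moment hp.1 hB) hB hV₁').mono ?_
  rintro t5 χ hF ⟨ht5, P₂, s₂, κ₂, U₂, V₂, hG₂, fR, hV₂, fs⟩
  have f0 := (hF.natVar 0 (by decide)).trans e0
  have f1 := (hF.natVar 1 (by decide)).trans e1
  have f2 := (hF.natVar 2 (by decide)).trans e2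
  have ff : ∀ i, χ.natArr 1 i = 0 := fun i => by rw [hF.natArr 1 (by decide), ef]
  clear hF e0 e1 e2 ef eW eY
  have hdet₂ : V₂.det * ((V₁ * X).submatrix id s₂).det = 1 := by rw [← det_mul, hV₂, det_one]
  have hs₂ : (V₂ * (V₁ * X)).submatrix id s₂ = 1 := hV₂
  obtain ⟨hinj, hmom⟩ := moment_indicatorWeight_image hs₂
  have ht₂ : 0 < V₂.det ^ 2 := by
    have : V₂.det ≠ 0 := left_ne_zero_of_mul_eq_one hdet₂
    positivity
  -- After the second change of coordinates the chosen columns are the standard basis, so the greedy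
  -- phase can start from `B = 1`.
  have hfac : m.factorial * (moment (V₂ * (V₁ * X)) p).det ≤
      (moment (V₂ * (V₁ * X)) (indicatorWeight (univ.image s₂))).det := by
    rw [hmom, det_one, det_moment_mul]
    have := mul_le_mul_of_nonneg_left (hG₂.factorial_mul_det_le hB hp rfl) (sq_nonneg V₂.det)
    rw [← mul_pow, hdet₂, one_pow] at this
    linarith
  apply wp_seq
  apply wp_setReal
  apply wp_seq
  simp only [RExp.eval, NExp.eval, RExp.cost, NExp.cost, Nat.cast_one]
  refine (wp_rescale_mat (σ := χ.setReal 3 1) (by decide) hm hn f0 f1 fR).mono ?_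
  rintro t6 φ hF ⟨ht6, gW, gY⟩
  simp only [setReal_realVar, if_true, one_smul] at gY
  have g0 := (hF.natVar 0 (by decide)).trans f0
  have g1 := (hF.natVar 1 (by decide)).trans f1
  have g2 := (hF.natVar 2 (by decide)).trans f2
  have gf : ∀ i, φ.natArr 1 i = 0 := fun i => by
    rw [hF.natArr 1 (by decide), setReal_natArr, ff]
  have gs : ∀ l : Fin m, φ.natArr 0 l = s₂ l := fun l => by
    rw [hF.natArr 0 (by decide), setReal_natArr, fs]
  clear hF f0 f1 f2 ff fR fs
  apply wp_seq
  refine (wp_flagChosen g0 gf).mono ?_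
  rintro t7 ψ hF ⟨ht7, hfl⟩
  have i0 := (hF.natVar 0 (by decide)).trans g0
  have i1 := (hF.natVar 1 (by decide)).trans g1
  have i2 := (hF.natVar 2 (by decide)).trans g2
  have iW : ψ.mat m n 0 = V₂ * (V₁ * X) := by
    rw [← gW, Store.mat, hF.realArr 0 (by decide)]; rfl
  have iY : ψ.mat m n 1 = (1 : Matrix (Fin m) (Fin m) ℝ) * (V₂ * (V₁ * X)) := by
    rw [← gY, Store.mat, hF.realArr 1 (by decide)]; rfl
  have is : ∀ l : Fin m, ψ.natArr 0 l = s₂ l := fun l => by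
    rw [hF.natArr 0 (by decide), gs]
  have hmem : ∀ i : Fin n, i ∈ univ.image s₂ ↔ ∃ l < m, φ.natArr 0 l = i := by
    intro i
    rw [mem_image]
    constructor
    · rintro ⟨l, -, rfl⟩
      exact ⟨l, l.2, gs l⟩
    · rintro ⟨l, hl, hi⟩
      exact ⟨⟨l, hl⟩, mem_univ _, Fin.ext ((gs ⟨l, hl⟩).symm.trans hi)⟩
  have h0eq := hF.natArr 0 (by decide)
  clear hF g0 g1 g2 gf gW gY
  refine (wp_extend (S₀ := univ.image s₂) hm hmk (by omega) hkn i0 i1 i2 iW iY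
    (by rw [hmom, Matrix.one_mul]) ⟨?_, ?_, ?_⟩ ?_ hp hfac).mono ?_
  · rw [card_image_of_injective _ hinj, card_univ, Fintype.card_fin]
  · intro l hl
    rw [is ⟨l, hl⟩]
    exact (s₂ _).2
  · rw [h0eq]
    exact hmem
  · intro i
    rw [hfl i, hmem i]
    push Not
    rfl
  rintro t8 ξ - ⟨ht8, S, hS, hlow⟩
  refine ⟨?_, S, hS.outputs, hS.card, (moment X p).det, ?_, ?_, ?_⟩
  · have h1 : m ≤ n * m ^ 2 := by nlinarith [Nat.mul_pos hn hm]
    have h2 : n * m ≤ n * m ^ 2 := by nlinarith [Nat.mul_pos hn hm]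
    omega
  · have := det_pos_of_mul_moment hp.1 hB
    rw [det_moment_mul] at this
    exact pos_of_mul_pos_right this ht₁.le
  -- Both sides carry the factor `det (V₂ V₁) ^ 2`, which cancels.
  · simp only [det_moment_mul] at hlow
    have ht : 0 < V₂.det ^ 2 * V₁.det ^ 2 := mul_pos ht₂ ht₁
    refine hlow.imp (fun h => ?_) fun h => ?_
    · refine le_of_mul_le_mul_left ?_ ht
      linarith
    · refine le_of_mul_le_mul_left ?_ ht
      linarith
  · intro T hT
    have h := det_moment_indicatorWeight_le hm hp.1 hB hmax T
    rw [det_moment_mul, det_moment_mul, hT] at h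
    refine le_of_mul_le_mul_left ?_ ht₁
    linarith

theorem colVolume_le {k : ℕ} {c d : ℝ} {X : Matrix (Fin m) (Fin n) ℝ} {S T : Finset (Fin n)}
    (hm : 1 ≤ m) (hmk : m ≤ k) (hkm : k ≤ 2 * m - 1) (hc : 1 < c) (hd : 0 < d)
    (hS : (m : ℝ) ^ m * d ≤ (moment X (indicatorWeight S)).det ∨
      2 ^ (k - m) * m.factorial * d ≤ (moment X (indicatorWeight S)).det)
    (hT : (moment X (indicatorWeight T)).det ≤ (k * c ^ 2) ^ m * d) :
    c ^ (-(m : ℤ)) / Real.sqrt ((2 * m - 1).choose m : ℝ) * colVolume X T ≤ colVolume X S := by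
  have hc0 : 0 < c := by linarith
  have hb : (0 : ℝ) < (2 * m - 1).choose m := by
    exact_mod_cast Nat.choose_pos (by omega)
  have hkS : (k : ℝ) ^ m * d ≤ (2 * m - 1).choose m * (moment X (indicatorWeight S)).det := by
    rcases hS with hS | hS
    · have h1 : (k : ℝ) ^ m ≤ (2 * m - 1).choose m * (m : ℝ) ^ m := by
        exact_mod_cast pow_le_choose_mul_pow hkm
      calc (k : ℝ) ^ m * d ≤ (2 * m - 1).choose m * (m : ℝ) ^ m * d := by gcongr
        _ = (2 * m - 1).choose m * ((m : ℝ) ^ m * d) := by ring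
        _ ≤ _ := by gcongr
    · have h1 := pow_le_choose_mul_two_pow hm hmk hkm
      calc (k : ℝ) ^ m * d ≤ (2 * m - 1).choose m * (2 ^ (k - m) * m.factorial) * d := by gcongr
        _ = (2 * m - 1).choose m * (2 ^ (k - m) * m.factorial * d) := by ring
        _ ≤ _ := by gcongr
  rw [colVolume_eq, colVolume_eq, _root_.zpow_neg, _root_.zpow_natCast]
  have hle : (moment X (indicatorWeight T)).det ≤
      (c ^ m) ^ 2 * ((2 * m - 1).choose m * (moment X (indicatorWeight S)).det) := by
    calc _ ≤ (k * c ^ 2) ^ m * d := hT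
      _ = (c ^ m) ^ 2 * ((k : ℝ) ^ m * d) := by rw [mul_pow]; ring
      _ ≤ _ := by gcongr
  have h2 := Real.sqrt_le_sqrt hle
  rw [Real.sqrt_mul (by positivity), Real.sqrt_sq (by positivity), Real.sqrt_mul hb.le] at h2
  have hs : 0 < Real.sqrt ((2 * m - 1).choose m : ℝ) := Real.sqrt_pos.2 hb
  rw [inv_eq_one_div, div_div, div_mul_eq_mul_div, one_mul, div_le_iff₀ (by positivity)]
  linarith

end RealRAM

theorem mainTheorem4 :
    ∃ (P : RealRAM.Program) (C : ℝ), 0 < C ∧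
      ∀ (m n k : ℕ) (c : ℝ) (X : Matrix (Fin m) (Fin n) ℝ),
        m ≤ n → X.rank = m → m ≤ k → k ≤ 2 * m - 1 → 1 ≤ m → k ≤ n → 1 < c →
        ∃ (S : Finset (Fin n)) (t : ℕ) (τ : RealRAM.Store),
          RealRAM.Exec P (RealRAM.input X k c) t τ ∧
          RealRAM.Outputs τ S ∧
          S.card = k ∧
          (∀ T : Finset (Fin n), T.card = k →
            c ^ (-(m : ℤ)) / Real.sqrt ((2 * m - 1).choose m : ℝ) * colVolume X T
              ≤ colVolume X S) ∧
          (t : ℝ) ≤ C * ((n : ℝ) * (m : ℝ) ^ 2 * max 1 (Real.log (Real.log m))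
            + (n : ℝ) * (m : ℝ) ^ 2 / Real.log c) := by
  refine ⟨RealRAM.selectColumns, 10000, by norm_num, ?_⟩
  intro m n k c X hmn hrank hmk hkm hm hkn hc
  have hL := Real.log_pos hc
  set v := ⌈m * (8 * max 1 (Real.log (Real.log m)) + 20 / (2 * Real.log c))⌉₊ with hvdef
  obtain ⟨t, τ, hE, ht, S, hO, hcard, d, hd, hlow, hup⟩ :=
    RealRAM.wp_selectColumns hm hrank hmk hkm hkn hc (v := v) (Nat.le_ceil _)
  refine ⟨S, t, τ, hE, hO, hcard,
    fun T hT => RealRAM.colVolume_le hm hmk hkm hc hd hlow (hup T hT), ?_⟩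
  have hv := (Nat.ceil_lt_add_one (a := m * (8 * max 1 (Real.log (Real.log m)) +
    20 / (2 * Real.log c))) (by positivity)).le
  rw [← hvdef] at hv
  have ht' : (t : ℝ) ≤ (v + 1) * (500 * (n * m)) + 3000 * (n * m ^ 2) := by exact_mod_cast ht
  have hm1 : (1 : ℝ) ≤ m := by exact_mod_cast hm
  -- For `m = 1` the iterated logarithm is `Real.log 0 = 0`, so the maximum is `1` as intended.
  have hmax : 1 ≤ max 1 (Real.log (Real.log m)) := le_max_left _ _
  generalize max 1 (Real.log (Real.log m)) = L at *
  have e : (20 : ℝ) / (2 * Real.log c) = 10 / Real.log c := by field_simp; norm_num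
  rw [e] at hv
  have hnm : (0 : ℝ) ≤ n * m := by positivity
  calc (t : ℝ) ≤ (v + 1) * (500 * (n * m)) + 3000 * (n * m ^ 2) := ht'
    -- One `1` comes from rounding `v` up, the other from the factor `v + 1`.
    _ ≤ (m * (8 * L + 10 / Real.log c) + 1 + 1) * (500 * (n * m)) + 3000 * (n * m ^ 2) := by gcongr
    _ = 4000 * (n * m ^ 2 * L) + 5000 * (n * m ^ 2 / Real.log c) + 1000 * (n * m) +
        3000 * (n * m ^ 2) := by ring
    _ ≤ 4000 * (n * m ^ 2 * L) + 10000 * (n * m ^ 2 / Real.log c) + 1000 * (n * m ^ 2 * L) +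
        3000 * (n * m ^ 2 * L) := by
      have h1 : (n : ℝ) * m ^ 2 ≤ n * m ^ 2 * L := le_mul_of_one_le_right (by positivity) hmax
      have h2 : (n : ℝ) * m ≤ n * m ^ 2 := by nlinarith
      have h3 : 0 ≤ (n : ℝ) * m ^ 2 / Real.log c := by positivity
      linarith
    _ ≤ _ := by
      have h1 : 0 ≤ (n : ℝ) * m ^ 2 * L := by positivity
      linarith
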